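/- The QISM I algebra is the unital associative complex algebra generated by the entries $A(u),B(u),C(u),D(u)$ of $T(u)=\begin{pmatrix}A(u)&B(u)\\C(u)&D(u)\end{pmatrix}$ ($u\in\mathbb C$) subject to $R(u-v)\,T^{(1)}(u)\,T^{(2)}(v)=T^{(2)}(v)\,T^{(1)}(u)\,R(u-v)$ for all $u,v\in\mathbb C$, where $T^{(1)}(u)=T(u)\otimes I$, $T^{(2)}(v)=I\otimes T(v)$, $R(u)=u+P$ and $P$ is the flip of $\mathbb C^2\otimes\mathbb C^2$. Its quantum determinant is $\Delta(u)=A(u-\tfrac12)D(u+\tfrac12)-C(u-\tfrac12)B(u+\tfrac12)$. Let the algebra act on a complex vector space $W$, and let $\mathcal D=\{u_0+m\mid m\in\mathbb Z,\ j_-<m<j_+\}$ with $u_0\in\mathbb C$, $j_-\in\mathbb Z\cup\{-\infty\}$, $j_+\in\mathbb Z\cup\{+\infty\}$. We say that the *string conditions* hold on $\mathcal D$ if (i) $\{w\in W\mid C(u)w=0\}$ is one-dimensional for each $u\in\mathcal D$, and (ii) whenever $u\in\mathcal D$, $0\ne w\in W$ and $C(u)w=0$, then $A(u)w=0$ if and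 only if $u=u_0+j_-+1$, and $D(u)w=0$ if and only if $u=u_0+j_+-1$ (never, if the respective end is infinite). Write $\partial=d/dx$. **Type B.** Let $a,c\in\mathbb C$ with $c\neq 0,-1,-2,\dots$, and let $W$ be the space of entire functions on $\mathbb C$. Then $$A(u)=x\partial-x+c-a-u,\quad B(u)=-x,\quad C(u)=-\bigl(x\partial^2+(c-x)\partial-a-u\bigr),\quad D(u)=x\partial+a+u$$ define a representation of the QISM I algebra on $W$, $B(u)$ is injective, and $\Delta(u)$ acts as the scalar $-u^2+(c-2a)u+a(c-a)-\tfrac12c+\tfrac14$. For every $u\in\mathbb C$ the function $F(u)(x)={}_1F_1(a+u;c;x)$ is a non-zero element of $W$ with $C(u)F(u)=0$, $A(u)F(u)=(c-a-u)F(u-1)$ and $D(u)F(u)=(a+u)F(u+1)$. The string conditions hold on $\mathcal D=u_0+\mathbb Z$ whenever $u_0\notin(-a+\mathbb Z)\cup(c-a+\mathbb Z)$, and on $\mathcal D=\{-a,-a-1,-a-2,\dots\}$ (with $u_0=-a$, $j_-=-\infty$, $j_+=1$). In the latter case $F(u)$ is a multiple of a Laguerre polynomial: $L_n^{c-1}(x)=\frac{(c)_n}{n!}F(-a-n)(x)$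 for $n=0,1,2,\dots$ **Type D'.** Let $W$ be the space of entire functions $f$ on $\mathbb C$ such that $f$ and all its derivatives are on $(0,\infty)$ of at most polynomial growth as $x\to\infty$. Then $$A(u)=\partial-x,\quad B(u)=-1,\quad C(u)=-(\partial^2-x\partial-u),\quad D(u)=\partial$$ define a representation of the QISM I algebra on $W$, $B(u)$ is injective, and $\Delta(u)$ acts as the scalar $u-\tfrac12$. For every $u\in\mathbb C$ the function $F(u)(x)=e^{x^2/4}D_{-u}(x)$, where $D_\nu$ is the parabolic cylinder function, is a non-zero element of $W$ with $C(u)F(u)=0$, $A(u)F(u)=-F(u-1)$, $D(u)F(u)=-uF(u+1)$, and $F(u)(x)=x^{-u}+O(x^{-u-2})$ as $x\to+\infty$. The string conditions hold on $\mathcal D=u_0+\mathbb Z$ whenever $u_0\notin\mathbb Z$, and on $\mathcal D=\{0,-1,-2,\dots\}$ (with $u_0=0$, $j_-=-\infty$, $j_+=1$). In the latter case $F(u)$ is a Hermite polynomial: $F(-n)(x)=He_n(x)=2^{-n/2}H_n(2^{-1/2}x)$ for $n=0,1,2,\dots$ -/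

import Mathlib

open Filter Asymptotics
open scoped Kronecker Nat

noncomputable section

/-! ### The QISM I algebra -/

namespace QISMI

/-- The rational R-matrix `R(u) = u + P` (with `κ = 1`), where `P` is the flip of `ℂ² ⊗ ℂ²`. -/
def R (u : ℂ) : Matrix (Fin 2 × Fin 2) (Fin 2 × Fin 2) ℂ :=
  u • (1 : Matrix (Fin 2 × Fin 2) (Fin 2 × Fin 2) ℂ) +
    Matrix.of fun p q => if p.1 = q.2 ∧ p.2 = q.1 then 1 else 0

/-- The free algebra on the symbols `T(u)_{ij}`, for `i, j ∈ {0, 1}` and `u ∈ ℂ`. -/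
abbrev Free : Type := FreeAlgebra ℂ (Fin 2 × Fin 2 × ℂ)

/-- The 2×2 matrix `T(u)` of free generators. -/
def freeT (u : ℂ) : Matrix (Fin 2) (Fin 2) Free :=
  Matrix.of fun i j => FreeAlgebra.ι ℂ (i, j, u)

/-- The 4×4 matrix `R(u)` with its scalar entries regarded in the free algebra. -/
def freeR (u : ℂ) : Matrix (Fin 2 × Fin 2) (Fin 2 × Fin 2) Free :=
  (R u).map (algebraMap ℂ Free)

/-- `T⁽¹⁾(u) = T(u) ⊗ I`. -/
def freeT₁ (u : ℂ) : Matrix (Fin 2 × Fin 2) (Fin 2 × Fin 2) Free :=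
  freeT u ⊗ₖ (1 : Matrix (Fin 2) (Fin 2) Free)

/-- `T⁽²⁾(v) = I ⊗ T(v)`. -/
def freeT₂ (v : ℂ) : Matrix (Fin 2 × Fin 2) (Fin 2 × Fin 2) Free :=
  (1 : Matrix (Fin 2) (Fin 2) Free) ⊗ₖ freeT v

/-- The entries of `R(u-v) T⁽¹⁾(u) T⁽²⁾(v) = T⁽²⁾(v) T⁽¹⁾(u) R(u-v)`. -/
inductive Rel : Free → Free → Prop
  | rtt (u v : ℂ) (p q : Fin 2 × Fin 2) :
      Rel ((freeR (u - v) * freeT₁ u * freeT₂ v) p q)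
        ((freeT₂ v * freeT₁ u * freeR (u - v)) p q)

end QISMI

/-- The QISM I algebra. -/
abbrev QISMI : Type := RingQuot QISMI.Rel

namespace QISMI

/-- The matrix `T(u)`, whose entries are the generators `A(u)`, `B(u)`, `C(u)`, `D(u)`. -/
def T (u : ℂ) : Matrix (Fin 2) (Fin 2) QISMI :=
  (freeT u).map (RingQuot.mkAlgHom ℂ Rel)

def A (u : ℂ) : QISMI := T u 0 0
def B (u : ℂ) : QISMI := T u 0 1
def C (u : ℂ) : QISMI := T u 1 0
def D (u : ℂ) : QISMI := T u 1 1

/-- The quantum determinant. -/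
def qdet (u : ℂ) : QISMI :=
  A (u - 1 / 2) * D (u + 1 / 2) - C (u - 1 / 2) * B (u + 1 / 2)

/-- For the string `𝒟 = {u₀ + m | m ∈ ℤ, j₋ < m < j₊}`, with `j₋ ∈ {-∞} ∪ ℤ` and `j₊ ∈ ℤ ∪ {+∞}`:
the null space of `C(u)` is one-dimensional for `u ∈ 𝒟`, and on a non-zero null vector of `C(u)`
the operator `A(u)` vanishes exactly at the lower end `u = u₀ + j₋ + 1` of `𝒟` and `D(u)` vanishes
exactly at the upper end `u = u₀ + j₊ - 1` of `𝒟` (never, if the end is infinite). -/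
structure StringConditions {W : Type*} [AddCommGroup W] [Module ℂ W]
    (ρ : QISMI →ₐ[ℂ] Module.End ℂ W) (u₀ : ℂ) (jm : WithBot ℤ) (jp : WithTop ℤ) : Prop where
  finrank_ker : ∀ m : ℤ, jm < m → (m : WithTop ℤ) < jp →
    Module.finrank ℂ (LinearMap.ker (ρ (C (u₀ + m)))) = 1
  lower : ∀ m : ℤ, jm < m → (m : WithTop ℤ) < jp →
    ∀ w : W, w ≠ 0 → ρ (C (u₀ + m)) w = 0 →
      (ρ (A (u₀ + m)) w = 0 ↔ jm + 1 = (m : WithBot ℤ))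
  upper : ∀ m : ℤ, jm < m → (m : WithTop ℤ) < jp →
    ∀ w : W, w ≠ 0 → ρ (C (u₀ + m)) w = 0 →
      (ρ (D (u₀ + m)) w = 0 ↔ (m : WithTop ℤ) + 1 = jp)

end QISMI

/-! ### Function spaces and the operators `∂` and `x` on them -/

/-- The entire functions on `ℂ`. -/
def entireFun : Submodule ℂ (ℂ → ℂ) where
  carrier := {f | Differentiable ℂ f}
  add_mem' hf hg := Differentiable.add hf hg
  zero_mem' := differentiable_const 0
  smul_mem' c _ hf := Differentiable.const_smul hf c

theorem contDiff_of_mem_entireFun {f : ℂ → ℂ} (hf : f ∈ entireFun) (n : WithTop ℕ∞) :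
    ContDiff ℂ n f :=
  Differentiable.contDiff hf

/-- The entire functions that have on `(0, ∞)`, together with all their derivatives, at most
polynomial growth as `x → ∞`. -/
def polyGrowthFun : Submodule ℂ (ℂ → ℂ) where
  carrier := {f | Differentiable ℂ f ∧ ∀ p : ℕ, ∃ N : ℕ,
    (fun x : ℝ => iteratedDeriv p f (x : ℂ)) =O[atTop] (fun x : ℝ => x ^ N)}
  add_mem' := by
    rintro f g ⟨hf, hf'⟩ ⟨hg, hg'⟩
    refine ⟨hf.add hg, fun p => ?_⟩
    obtain ⟨M, hM⟩ := hf' p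
    obtain ⟨N, hN⟩ := hg' p
    refine ⟨max M N, ?_⟩
    have h : (fun x : ℝ => iteratedDeriv p (f + g) (x : ℂ)) =
        fun x : ℝ => iteratedDeriv p f (x : ℂ) + iteratedDeriv p g (x : ℂ) := by
      funext x
      exact iteratedDeriv_add (contDiff_of_mem_entireFun hf _).contDiffAt
        (contDiff_of_mem_entireFun hg _).contDiffAt
    rw [h]
    have key : ∀ K L : ℕ, K ≤ L → (fun x : ℝ => x ^ K) =O[atTop] fun x : ℝ => x ^ L := by
      intro K L hKL
      refine IsBigO.of_bound 1 ?_
      filter_upwards [eventually_ge_atTop (1 : ℝ)] with x hx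
      have hx0 : 0 ≤ x := zero_le_one.trans hx
      rw [one_mul, Real.norm_of_nonneg (pow_nonneg hx0 _), Real.norm_of_nonneg (pow_nonneg hx0 _)]
      exact pow_le_pow_right₀ hx hKL
    exact (hM.trans (key _ _ (le_max_left _ _))).add (hN.trans (key _ _ (le_max_right _ _)))
  zero_mem' := by
    refine ⟨differentiable_const 0, fun p => ⟨0, ?_⟩⟩
    have h : (fun x : ℝ => iteratedDeriv p (0 : ℂ → ℂ) (x : ℂ)) = fun _ => 0 := by
      funext x
      simp
    rw [h]
    exact isBigO_zero _ _
  smul_mem' := by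
    rintro c f ⟨hf, hf'⟩
    refine ⟨hf.const_smul c, fun p => ?_⟩
    obtain ⟨M, hM⟩ := hf' p
    refine ⟨M, ?_⟩
    have h : (fun x : ℝ => iteratedDeriv p (c • f) (x : ℂ)) =
        fun x : ℝ => c • iteratedDeriv p f (x : ℂ) := by
      funext x
      exact iteratedDeriv_const_smul (contDiff_of_mem_entireFun hf _).contDiffAt c
    rw [h]
    exact hM.const_smul_left c

/-- A space of entire functions on which `∂ = d/dx` and multiplication by `x` act. -/
class StableSpace (W : Submodule ℂ (ℂ → ℂ)) : Prop where
  differentiable : ∀ f ∈ W, Differentiable ℂ f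
  deriv_mem : ∀ f ∈ W, deriv f ∈ W
  mul_mem : ∀ f ∈ W, (fun x : ℂ => x * f x) ∈ W

/-- The operator `∂ = d/dx` on `W`. -/
def opD (W : Submodule ℂ (ℂ → ℂ)) [StableSpace W] : Module.End ℂ W where
  toFun f := ⟨deriv (f : ℂ → ℂ), StableSpace.deriv_mem _ f.2⟩
  map_add' f g := by
    ext x
    exact deriv_add (StableSpace.differentiable _ f.2 x) (StableSpace.differentiable _ g.2 x)
  map_smul' c f := by
    ext x
    exact deriv_const_smul c (StableSpace.differentiable _ f.2 x)

/-- The operator of multiplication by `x` on `W`. -/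
def opX (W : Submodule ℂ (ℂ → ℂ)) [StableSpace W] : Module.End ℂ W where
  toFun f := ⟨fun x => x * (f : ℂ → ℂ) x, StableSpace.mul_mem _ f.2⟩
  map_add' f g := by
    ext x
    exact mul_add x _ _
  map_smul' c f := by
    ext x
    exact mul_left_comm x c _

theorem differentiable_deriv_of_entire {f : ℂ → ℂ} (hf : Differentiable ℂ f) :
    Differentiable ℂ (deriv f) := by
  have h : ContDiff ℂ 2 f := hf.contDiff
  exact (contDiff_succ_iff_deriv (n := 1)).1 (by exact_mod_cast h) |>.2.2.differentiable
    one_ne_zero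

instance : StableSpace entireFun where
  differentiable _ hf := hf
  deriv_mem _ hf := differentiable_deriv_of_entire hf
  mul_mem _ hf := differentiable_id.mul hf

theorem iteratedDeriv_id_mul_entire {f : ℂ → ℂ} (hf : Differentiable ℂ f) (p : ℕ) :
    iteratedDeriv p (fun x : ℂ => x * f x) =
      fun x => x * iteratedDeriv p f x + p * iteratedDeriv (p - 1) f x := by
  have hd : ∀ k : ℕ, Differentiable ℂ (iteratedDeriv k f) := fun k =>
    hf.contDiff.differentiable_iteratedDeriv k (WithTop.coe_lt_coe.2 (ENat.natCast_lt_top k))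
  induction p with
  | zero => funext x; simp
  | succ p ih =>
    rw [iteratedDeriv_succ, ih]
    funext x
    have h1 : HasDerivAt (fun x : ℂ => x * iteratedDeriv p f x + p * iteratedDeriv (p - 1) f x)
        ((1 * iteratedDeriv p f x + x * iteratedDeriv (p + 1) f x) +
          p * iteratedDeriv ((p - 1) + 1) f x) x := by
      refine ((hasDerivAt_id x).mul ?_).add (HasDerivAt.const_mul _ ?_)
      · rw [iteratedDeriv_succ]; exact (hd p x).hasDerivAt
      · rw [iteratedDeriv_succ]; exact (hd (p - 1) x).hasDerivAt
    rw [h1.deriv]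
    rcases p with _ | p
    · simp; ring
    · simp only [Nat.add_sub_cancel]; push_cast; ring

instance : StableSpace polyGrowthFun where
  differentiable _ hf := hf.1
  deriv_mem f hf := by
    refine ⟨differentiable_deriv_of_entire hf.1, fun p => ?_⟩
    rw [← iteratedDeriv_succ']
    exact hf.2 (p + 1)
  mul_mem f hf := by
    refine ⟨differentiable_id.mul hf.1, fun p => ?_⟩
    obtain ⟨M, hM⟩ := hf.2 p
    obtain ⟨N, hN⟩ := hf.2 (p - 1)
    refine ⟨(M + 1) + N, ?_⟩
    rw [iteratedDeriv_id_mul_entire hf.1]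
    have key : ∀ K L : ℕ, K ≤ L → (fun x : ℝ => x ^ K) =O[atTop] fun x : ℝ => x ^ L := by
      intro K L hKL
      refine IsBigO.of_bound 1 ?_
      filter_upwards [eventually_ge_atTop (1 : ℝ)] with x hx
      have hx0 : 0 ≤ x := zero_le_one.trans hx
      rw [one_mul, Real.norm_of_nonneg (pow_nonneg hx0 _), Real.norm_of_nonneg (pow_nonneg hx0 _)]
      exact pow_le_pow_right₀ hx hKL
    have hx : (fun x : ℝ => (x : ℂ)) =O[atTop] fun x : ℝ => x :=
      IsBigO.of_bound 1 (Eventually.of_forall fun x => by simp)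
    refine IsBigO.add ?_ ?_
    · refine ((hx.mul hM).congr_right fun x => ?_).trans (key (M + 1) _ (by omega))
      ring
    · exact (hN.const_mul_left _).trans (key N _ (by omega))

/-! ### The L-operators -/

/-- Type B:
`A(u) = x∂ - x + c - a - u`, `B(u) = -x`, `C(u) = -(x∂² + (c - x)∂ - a - u)`,
`D(u) = x∂ + a + u`, on the entire functions. -/
def typeB (a c u : ℂ) : Matrix (Fin 2) (Fin 2) (Module.End ℂ entireFun) :=
  let d := opD entireFun
  let x := opX entireFun
  !![x * d - x + (c - a - u) • 1, -x;
     -(x * d ^ 2 + (c • 1 - x) * d - (a + u) • 1), x * d + (a + u) • 1]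

/-- Type D':
`A(u) = ∂ - x`, `B(u) = -1`, `C(u) = -(∂² - x∂ - u)`, `D(u) = ∂`,
on the entire functions of polynomial growth. -/
def typeD' (u : ℂ) : Matrix (Fin 2) (Fin 2) (Module.End ℂ polyGrowthFun) :=
  let d := opD polyGrowthFun
  let x := opX polyGrowthFun
  !![d - x, -1; -(d ^ 2 - x * d - u • 1), d]

/-! ### Special functions -/

/-- The confluent hypergeometric function `₁F₁(a; c; x) = ∑ (a)_k / ((c)_k k!) x^k`
(for `c ≠ 0, -1, -2, …`). -/
def oneFOne (a c x : ℂ) : ℂ :=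
  ∑' k : ℕ, (ascPochhammer ℂ k).eval a / ((ascPochhammer ℂ k).eval c * (k ! : ℂ)) * x ^ k

/-- The parabolic cylinder function `D_ν(x)`, entire in `ν` and `x`. This is
`2^{(ν-1)/2} e^{-x²/4} x Ψ((1-ν)/2, 3/2; x²/2)` with Tricomi's `Ψ(α, γ; y)` written out as
`Γ(1-γ)/Γ(α-γ+1) ₁F₁(α; γ; y) + Γ(γ-1)/Γ(α) y^{1-γ} ₁F₁(α-γ+1; 2-γ; y)`; `1/Γ` is `0` at the
poles of `Γ`. -/
def parabolicCylinderD (ν x : ℂ) : ℂ :=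
  (2 : ℂ) ^ (ν / 2) * Complex.exp (-x ^ 2 / 4) * (Real.sqrt Real.pi : ℂ) *
    (oneFOne (-ν / 2) (1 / 2) (x ^ 2 / 2) / Complex.Gamma ((1 - ν) / 2) -
      (Real.sqrt 2 : ℂ) * x * oneFOne ((1 - ν) / 2) (3 / 2) (x ^ 2 / 2) /
        Complex.Gamma (-ν / 2))

/-- The Laguerre polynomial `L_n^α(x) = ∑_{k ≤ n} (-1)^k binom(n+α, n-k) x^k / k!`, where
`binom(n+α, n-k) = (α+k+1)_{n-k} / (n-k)!`. -/
def laguerre (n : ℕ) (α x : ℂ) : ℂ :=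
  ∑ k ∈ Finset.range (n + 1),
    (-1) ^ k * ((ascPochhammer ℂ (n - k)).eval (α + k + 1) / ((n - k)! : ℂ)) * x ^ k / (k ! : ℂ)

end

/-!
The RTT relation contains `C(u-1) A(u) = A(u-1) C(u)` and `C(u+1) D(u) = D(u+1) C(u)`, so `A(u)` and
`D(u)` carry null vectors of `C(u)` to null vectors of `C(u-1)` and `C(u+1)`. Where the null spaces
are lines spanned by functions `F(u)` with known Taylor coefficients at `0`, comparing those
coefficients gives the factors by which `A(u)` and `D(u)` move along the `F(u)`, and the string
conditions only ask where these factors vanish.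

In type B, `C(u)` is the Kummer operator, whose entire solutions are determined by their value at
`0`. In type D' it is the Hermite operator, with a two-dimensional space of entire solutions, the
substitution `y = x²/2` reducing it to the Kummer operator. The Wronskian of two solutions is a
multiple of `e^{x²/2}`, so only a line of them has polynomial growth. That `e^{x²/4} D_{-u}(x)` is
in this line, with leading term `x^{-u}`, follows for `Re u > 0` from
`Γ(u) e^{x²/4} D_{-u}(x) = ∫₀^∞ t^{u-1} e^{-xt - t²/2} dt`, and for all `u` from a three-term
recurrence in `u`.
-/

/-! ### Representations of the QISM I algebra -/

namespace QISMI

section RTT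

variable {E : Type*} [Ring E] [Algebra ℂ E]

/-- The RTT relation for a family `t u` of `2 × 2` matrices over an algebra, written out in matrix
entries: `R(u - v)` acts on a pair of row (or column) indices as `u - v` plus their exchange. -/
def SatisfiesRTT (t : ℂ → Matrix (Fin 2) (Fin 2) E) : Prop :=
  ∀ (u v : ℂ) (i j k l : Fin 2),
    (u - v) • (t u i j * t v k l) + t u k j * t v i l =
      (u - v) • (t v k l * t u i j) + t v k j * t u i l

theorem freeR_apply (w : ℂ) (p q : Fin 2 × Fin 2) :
    freeR w p q = (if p = q then algebraMap ℂ Free w else 0) + if p.swap = q then 1 else 0 := by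
  have hswap : (p.1 = q.2 ∧ p.2 = q.1) ↔ p.swap = q := by
    rw [Prod.ext_iff, and_comm]
    rfl
  simp only [freeR, R, Matrix.map_apply, Matrix.add_apply, Matrix.smul_apply, Matrix.one_apply,
    Matrix.of_apply, map_add, smul_eq_mul, hswap]
  split_ifs <;> simp

theorem freeR_mul_apply (w : ℂ) (M : Matrix (Fin 2 × Fin 2) (Fin 2 × Fin 2) Free)
    (p q : Fin 2 × Fin 2) : (freeR w * M) p q = w • M p q + M p.swap q := by
  simp only [Matrix.mul_apply, freeR_apply, add_mul, ite_mul, zero_mul, one_mul,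
    Finset.sum_add_distrib, Finset.sum_ite_eq, Finset.mem_univ, if_true, Algebra.smul_def]

theorem mul_freeR_apply (w : ℂ) (M : Matrix (Fin 2 × Fin 2) (Fin 2 × Fin 2) Free)
    (p q : Fin 2 × Fin 2) : (M * freeR w) p q = w • M p q + M p q.swap := by
  have hswap (r : Fin 2 × Fin 2) : r.swap = q ↔ r = q.swap :=
    ⟨fun h => by rw [← h, Prod.swap_swap], fun h => by rw [h, Prod.swap_swap]⟩
  simp only [Matrix.mul_apply, freeR_apply, mul_add, mul_ite, mul_zero, mul_one, hswap,
    Finset.sum_add_distrib, Finset.sum_ite_eq', Finset.mem_univ, if_true, Algebra.smul_def,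
    Algebra.commutes]

theorem freeT₁_mul_freeT₂_apply (u v : ℂ) (p q : Fin 2 × Fin 2) :
    (freeT₁ u * freeT₂ v) p q = freeT u p.1 q.1 * freeT v p.2 q.2 := by
  simp [Matrix.mul_apply, freeT₁, freeT₂, Fintype.sum_prod_type, Matrix.one_apply]

theorem freeT₂_mul_freeT₁_apply (u v : ℂ) (p q : Fin 2 × Fin 2) :
    (freeT₂ v * freeT₁ u) p q = freeT v p.2 q.2 * freeT u p.1 q.1 := by
  simp [Matrix.mul_apply, freeT₁, freeT₂, Fintype.sum_prod_type, Matrix.one_apply]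

theorem freeR_mul_freeT₁_mul_freeT₂_apply (u v : ℂ) (p q : Fin 2 × Fin 2) :
    (freeR (u - v) * freeT₁ u * freeT₂ v) p q =
      (u - v) • (freeT u p.1 q.1 * freeT v p.2 q.2) + freeT u p.2 q.1 * freeT v p.1 q.2 := by
  rw [mul_assoc, freeR_mul_apply, freeT₁_mul_freeT₂_apply, freeT₁_mul_freeT₂_apply,
    Prod.fst_swap, Prod.snd_swap]

theorem freeT₂_mul_freeT₁_mul_freeR_apply (u v : ℂ) (p q : Fin 2 × Fin 2) :
    (freeT₂ v * freeT₁ u * freeR (u - v)) p q =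
      (u - v) • (freeT v p.2 q.2 * freeT u p.1 q.1) + freeT v p.2 q.1 * freeT u p.1 q.2 := by
  rw [mul_freeR_apply, freeT₂_mul_freeT₁_apply, freeT₂_mul_freeT₁_apply, Prod.fst_swap,
    Prod.snd_swap]

theorem satisfiesRTT_T : SatisfiesRTT T := fun u v i j k l => by
  have h := RingQuot.mkAlgHom_rel ℂ (Rel.rtt u v (i, k) (j, l))
  simp only [freeR_mul_freeT₁_mul_freeT₂_apply, freeT₂_mul_freeT₁_mul_freeR_apply, map_add,
    map_smul, map_mul] at h
  exact h

variable {t : ℂ → Matrix (Fin 2) (Fin 2) E}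

theorem SatisfiesRTT.lowerLeft_mul_upperLeft (ht : SatisfiesRTT t) (u : ℂ) :
    t (u - 1) 1 0 * t u 0 0 = t (u - 1) 0 0 * t u 1 0 := by
  have h := ht (u - 1) u 1 0 0 0
  rw [sub_sub_cancel_left, neg_one_smul, neg_one_smul, neg_add_cancel] at h
  exact neg_add_eq_zero.1 h

theorem SatisfiesRTT.lowerLeft_mul_lowerRight (ht : SatisfiesRTT t) (u : ℂ) :
    t (u + 1) 1 0 * t u 1 1 = t (u + 1) 1 1 * t u 1 0 := by
  have h := ht u (u + 1) 1 0 1 1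
  rw [sub_add_cancel_left, neg_one_smul, neg_one_smul, neg_add_cancel] at h
  exact (neg_add_eq_zero.1 h.symm).symm

theorem freeLift_freeT (u : ℂ) (i j : Fin 2) :
    FreeAlgebra.lift ℂ (fun g : Fin 2 × Fin 2 × ℂ => t g.2.2 g.1 g.2.1) (freeT u i j) = t u i j :=
  FreeAlgebra.lift_ι_apply _ _

theorem SatisfiesRTT.freeLift_eq (ht : SatisfiesRTT t) ⦃a b : Free⦄ (hab : Rel a b) :
    FreeAlgebra.lift ℂ (fun g : Fin 2 × Fin 2 × ℂ => t g.2.2 g.1 g.2.1) a =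
      FreeAlgebra.lift ℂ (fun g : Fin 2 × Fin 2 × ℂ => t g.2.2 g.1 g.2.1) b := by
  obtain ⟨u, v, p, q⟩ := hab
  simpa only [freeR_mul_freeT₁_mul_freeT₂_apply, freeT₂_mul_freeT₁_mul_freeR_apply, map_add,
    map_smul, map_mul, freeLift_freeT] using ht u v p.1 q.1 p.2 q.2

/-- The homomorphism from the QISM I algebra that sends the generators `T(u)` to given matrices
`t u` satisfying the RTT relation. -/
noncomputable def lift (ht : SatisfiesRTT t) : QISMI →ₐ[ℂ] E :=
  RingQuot.liftAlgHom ℂ ⟨FreeAlgebra.lift ℂ fun g => t g.2.2 g.1 g.2.1, ht.freeLift_eq⟩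

theorem lift_T (ht : SatisfiesRTT t) (u : ℂ) (i j : Fin 2) : lift ht (T u i j) = t u i j :=
  (RingQuot.liftAlgHom_mkAlgHom_apply ℂ _ _ _).trans (freeLift_freeT u i j)

theorem map_T_lift (ht : SatisfiesRTT t) (u : ℂ) : (T u).map (lift ht) = t u :=
  Matrix.ext (lift_T ht u)

end RTT

theorem C_mul_A (u : ℂ) : C (u - 1) * A u = A (u - 1) * C u :=
  satisfiesRTT_T.lowerLeft_mul_upperLeft u

theorem C_mul_D (u : ℂ) : C (u + 1) * D u = D (u + 1) * C u :=
  satisfiesRTT_T.lowerLeft_mul_lowerRight u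

/-! ### Ladders of null vectors -/

section Ladder

variable {W : Type*} [AddCommGroup W] [Module ℂ W] {ρ : QISMI →ₐ[ℂ] Module.End ℂ W}

theorem A_apply_mem_ker_C {u : ℂ} {w : W} (hw : w ∈ LinearMap.ker (ρ (C u))) :
    ρ (A u) w ∈ LinearMap.ker (ρ (C (u - 1))) := by
  rw [LinearMap.mem_ker] at hw ⊢
  rw [← Module.End.mul_apply, ← map_mul, C_mul_A, map_mul, Module.End.mul_apply, hw, map_zero]

theorem D_apply_mem_ker_C {u : ℂ} {w : W} (hw : w ∈ LinearMap.ker (ρ (C u))) :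
    ρ (D u) w ∈ LinearMap.ker (ρ (C (u + 1))) := by
  rw [LinearMap.mem_ker] at hw ⊢
  rw [← Module.End.mul_apply, ← map_mul, C_mul_D, map_mul, Module.End.mul_apply, hw, map_zero]

/-- A family of non-zero vectors `F u` spanning the null spaces of `C(u)`, on which `A(u)` and
`D(u)` act as lowering and raising operators with coefficients `α u` and `β u`. -/
structure IsLadder (ρ : QISMI →ₐ[ℂ] Module.End ℂ W) (F : ℂ → W) (α β : ℂ → ℂ) : Prop where
  ne_zero : ∀ u, F u ≠ 0
  ker_C : ∀ u, LinearMap.ker (ρ (C u)) = ℂ ∙ F u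
  A_apply : ∀ u, ρ (A u) (F u) = α u • F (u - 1)
  D_apply : ∀ u, ρ (D u) (F u) = β u • F (u + 1)

namespace IsLadder

variable {F : ℂ → W} {α β : ℂ → ℂ}

theorem C_apply (hF : IsLadder ρ F α β) (u : ℂ) : ρ (C u) (F u) = 0 := by
  rw [← LinearMap.mem_ker, hF.ker_C]
  exact Submodule.mem_span_singleton_self _

theorem finrank_ker_C (hF : IsLadder ρ F α β) (u : ℂ) :
    Module.finrank ℂ (LinearMap.ker (ρ (C u))) = 1 := by
  rw [hF.ker_C, finrank_span_singleton (hF.ne_zero u)]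

theorem exists_eq_smul (hF : IsLadder ρ F α β) {u : ℂ} {w : W} (hw : w ≠ 0) (hCw : ρ (C u) w = 0) :
    ∃ r : ℂ, r ≠ 0 ∧ w = r • F u := by
  rw [← LinearMap.mem_ker, hF.ker_C, Submodule.mem_span_singleton] at hCw
  obtain ⟨r, rfl⟩ := hCw
  exact ⟨r, left_ne_zero_of_smul hw, rfl⟩

theorem A_apply_eq_zero_iff (hF : IsLadder ρ F α β) {u : ℂ} {w : W} (hw : w ≠ 0)
    (hCw : ρ (C u) w = 0) : ρ (A u) w = 0 ↔ α u = 0 := by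
  obtain ⟨r, hr, rfl⟩ := hF.exists_eq_smul hw hCw
  rw [map_smul, hF.A_apply, smul_eq_zero_iff_right hr, smul_eq_zero_iff_left (hF.ne_zero _)]

theorem D_apply_eq_zero_iff (hF : IsLadder ρ F α β) {u : ℂ} {w : W} (hw : w ≠ 0)
    (hCw : ρ (C u) w = 0) : ρ (D u) w = 0 ↔ β u = 0 := by
  obtain ⟨r, hr, rfl⟩ := hF.exists_eq_smul hw hCw
  rw [map_smul, hF.D_apply, smul_eq_zero_iff_right hr, smul_eq_zero_iff_left (hF.ne_zero _)]

theorem stringConditions (hF : IsLadder ρ F α β) {u₀ : ℂ} {jm : WithBot ℤ} {jp : WithTop ℤ}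
    (hα : ∀ m : ℤ, jm < m → (m : WithTop ℤ) < jp →
      (α (u₀ + m) = 0 ↔ jm + 1 = (m : WithBot ℤ)))
    (hβ : ∀ m : ℤ, jm < m → (m : WithTop ℤ) < jp →
      (β (u₀ + m) = 0 ↔ (m : WithTop ℤ) + 1 = jp)) :
    StringConditions ρ u₀ jm jp where
  finrank_ker _ _ _ := hF.finrank_ker_C _
  lower m hjm hjp _ hw hCw := (hF.A_apply_eq_zero_iff hw hCw).trans (hα m hjm hjp)
  upper m hjm hjp _ hw hCw := (hF.D_apply_eq_zero_iff hw hCw).trans (hβ m hjm hjp)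

theorem stringConditions_bot_top (hF : IsLadder ρ F α β) {u₀ : ℂ} (hα : ∀ m : ℤ, α (u₀ + m) ≠ 0)
    (hβ : ∀ m : ℤ, β (u₀ + m) ≠ 0) : StringConditions ρ u₀ ⊥ ⊤ :=
  hF.stringConditions
    (fun m _ _ => iff_of_false (hα m) (by rw [WithBot.bot_add]; exact WithBot.bot_ne_coe))
    fun m _ _ => iff_of_false (hβ m) (by exact_mod_cast WithTop.coe_ne_top)

theorem stringConditions_bot_one (hF : IsLadder ρ F α β) {u₀ : ℂ} (hα : ∀ n : ℕ, α (u₀ - n) ≠ 0)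
    (hβ : ∀ n : ℕ, β (u₀ - n) = 0 ↔ n = 0) : StringConditions ρ u₀ ⊥ 1 := by
  have exists_nat {m : ℤ} (hm : (m : WithTop ℤ) < 1) : ∃ n : ℕ, m = -n := by
    have : m < 1 := by exact_mod_cast hm
    exact ⟨(-m).toNat, by omega⟩
  refine hF.stringConditions (fun m _ hm => iff_of_false ?_ ?_) fun m _ hm => ?_
  · obtain ⟨n, rfl⟩ := exists_nat hm
    simpa [← sub_eq_add_neg] using hα n
  · rw [WithBot.bot_add]
    exact WithBot.bot_ne_coe
  · obtain ⟨n, rfl⟩ := exists_nat hm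
    have : ((-n : ℤ) : WithTop ℤ) + 1 = 1 ↔ n = 0 := by
      norm_cast
      omega
    simpa [← sub_eq_add_neg, this] using hβ n

end IsLadder

end Ladder

end QISMI

/-! ### The L-operators over a Weyl pair -/

section Weyl

variable {E : Type*} [Ring E] {x d : E}

theorem mul_mul_of_weyl (h : d * x = x * d + 1) (y : E) : d * (x * y) = x * (d * y) + y := by
  rw [← mul_assoc, h, add_mul, one_mul, mul_assoc]

variable [Algebra ℂ E]

/-- The Kummer operator `x∂² + (c - x)∂ - a`, for any elements `x` and `d = ∂` of an algebra. -/
def kummerOp (x d : E) (a c : ℂ) : E := x * d ^ 2 + (c • 1 - x) * d - a • 1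

/-- The Hermite operator `∂² - x∂ - u`, for any elements `x` and `d = ∂` of an algebra. -/
def hermiteOp (x d : E) (u : ℂ) : E := d ^ 2 - x * d - u • 1

/-- The L-operator of type B in terms of `x` and `d = ∂`. -/
def lOperatorB (x d : E) (a c u : ℂ) : Matrix (Fin 2) (Fin 2) E :=
  !![x * d - x + (c - a - u) • 1, -x; -kummerOp x d (a + u) c, x * d + (a + u) • 1]

/-- The L-operator of type D' in terms of `x` and `d = ∂`. -/
def lOperatorD' (x d : E) (u : ℂ) : Matrix (Fin 2) (Fin 2) E :=
  !![d - x, -1; -hermiteOp x d u, d]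

theorem satisfiesRTT_lOperatorB (h : d * x = x * d + 1) (a c : ℂ) :
    QISMI.SatisfiesRTT (lOperatorB x d a c) := by
  have h' := mul_mul_of_weyl h
  intro u v i j k l
  fin_cases i <;> fin_cases j <;> fin_cases k <;> fin_cases l <;>
    simp [lOperatorB, kummerOp, sq, mul_add, add_mul, mul_sub, sub_mul, mul_assoc, h, h'] <;>
    module

theorem satisfiesRTT_lOperatorD' (h : d * x = x * d + 1) :
    QISMI.SatisfiesRTT (lOperatorD' x d) := by
  have h' := mul_mul_of_weyl h
  intro u v i j k l
  fin_cases i <;> fin_cases j <;> fin_cases k <;> fin_cases l <;>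
    simp [lOperatorD', hermiteOp, sq, mul_add, mul_sub, sub_mul, mul_assoc, h, h'] <;> module

theorem qdet_lOperatorB (h : d * x = x * d + 1) (a c u : ℂ) :
    lOperatorB x d a c (u - 1 / 2) 0 0 * lOperatorB x d a c (u + 1 / 2) 1 1 -
      lOperatorB x d a c (u - 1 / 2) 1 0 * lOperatorB x d a c (u + 1 / 2) 0 1 =
    (-u ^ 2 + (c - 2 * a) * u + (a * (c - a) - c / 2 + 1 / 4)) • 1 := by
  have h' := mul_mul_of_weyl h
  simp only [lOperatorB, kummerOp, Matrix.of_apply, Matrix.cons_val', Matrix.cons_val_zero,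
    Matrix.cons_val_one, Matrix.cons_val_fin_one, sq, mul_add, add_mul, mul_sub, sub_mul, mul_assoc,
    h, h', smul_mul_assoc, mul_smul_comm, mul_neg, neg_mul, mul_one, one_mul]
  module

theorem qdet_lOperatorD' (x d : E) (u : ℂ) :
    lOperatorD' x d (u - 1 / 2) 0 0 * lOperatorD' x d (u + 1 / 2) 1 1 -
      lOperatorD' x d (u - 1 / 2) 1 0 * lOperatorD' x d (u + 1 / 2) 0 1 = (u - 1 / 2) • 1 := by
  simp [lOperatorD', hermiteOp, sq, sub_mul]

theorem hermiteOp_mul_of_sq_half (h : d * x = x * d + 1) {s : E}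
    (hd : d * s = x * (s * d)) (hx : x * (x * s) = (2 : ℂ) • (s * x)) (u : ℂ) :
    hermiteOp x d u * s = (2 : ℂ) • (s * kummerOp x d (u / 2) (1 / 2)) := by
  have h' := mul_mul_of_weyl h
  have hd' (y : E) : d * (s * y) = x * (s * (d * y)) := by
    rw [← mul_assoc, hd, mul_assoc, mul_assoc]
  have hx' (y : E) : x * (x * (s * y)) = (2 : ℂ) • (s * (x * y)) := by
    rw [← mul_assoc x s, ← mul_assoc x (x * s), hx, smul_mul_assoc, mul_assoc]
  simp only [kummerOp, hermiteOp, sq, mul_add, mul_sub, sub_mul, mul_assoc, h', hd, hd', hx',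
    mul_smul_comm, smul_mul_assoc, mul_one, one_mul]
  module

theorem hermiteOp_mul_mul_of_sq_half (h : d * x = x * d + 1) {s : E}
    (hd : d * s = x * (s * d)) (hx : x * (x * s) = (2 : ℂ) • (s * x)) (u : ℂ) :
    hermiteOp x d u * (x * s) = (2 : ℂ) • (x * (s * kummerOp x d ((1 + u) / 2) (3 / 2))) := by
  have h' := mul_mul_of_weyl h
  have hd' (y : E) : d * (s * y) = x * (s * (d * y)) := by
    rw [← mul_assoc, hd, mul_assoc, mul_assoc]
  have hx' (y : E) : x * (x * (s * y)) = (2 : ℂ) • (s * (x * y)) := by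
    rw [← mul_assoc x s, ← mul_assoc x (x * s), hx, smul_mul_assoc, mul_assoc]
  simp only [kummerOp, hermiteOp, sq, mul_add, mul_sub, sub_mul, mul_assoc, h', hd, hd', hx',
    mul_smul_comm, smul_mul_assoc, mul_one, one_mul]
  module

end Weyl

theorem opD_mul_opX (W : Submodule ℂ (ℂ → ℂ)) [StableSpace W] :
    opD W * opX W = opX W * opD W + 1 := by
  ext f x
  have hf := StableSpace.differentiable _ f.2 x
  exact ((hasDerivAt_id x).mul hf.hasDerivAt).deriv.trans (by simp [opX, opD, add_comm])

section Representations

variable (W : Submodule ℂ (ℂ → ℂ)) [StableSpace W]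

/-- The representation of type B of the QISM I algebra on a space of entire functions. -/
noncomputable def repB (a c : ℂ) : QISMI →ₐ[ℂ] Module.End ℂ W :=
  QISMI.lift (E := Module.End ℂ W) (satisfiesRTT_lOperatorB (opD_mul_opX W) a c)

/-- The representation of type D' of the QISM I algebra on a space of entire functions. -/
noncomputable def repD' : QISMI →ₐ[ℂ] Module.End ℂ W :=
  QISMI.lift (E := Module.End ℂ W) (satisfiesRTT_lOperatorD' (opD_mul_opX W))

theorem repB_T (a c u : ℂ) (i j : Fin 2) :
    repB W a c (QISMI.T u i j) = lOperatorB (opX W) (opD W) a c u i j :=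
  QISMI.lift_T _ u i j

theorem repD'_T (u : ℂ) (i j : Fin 2) :
    repD' W (QISMI.T u i j) = lOperatorD' (opX W) (opD W) u i j :=
  QISMI.lift_T _ u i j

theorem repB_A (a c u : ℂ) :
    repB W a c (QISMI.A u) = opX W * opD W - opX W + (c - a - u) • 1 :=
  repB_T W a c u 0 0

theorem repB_B (a c u : ℂ) : repB W a c (QISMI.B u) = -opX W :=
  repB_T W a c u 0 1

theorem repB_C (a c u : ℂ) : repB W a c (QISMI.C u) = -kummerOp (opX W) (opD W) (a + u) c :=
  repB_T W a c u 1 0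

theorem repB_D (a c u : ℂ) : repB W a c (QISMI.D u) = opX W * opD W + (a + u) • 1 :=
  repB_T W a c u 1 1

theorem repD'_A (u : ℂ) : repD' W (QISMI.A u) = opD W - opX W :=
  repD'_T W u 0 0

theorem repD'_B (u : ℂ) : repD' W (QISMI.B u) = -1 :=
  repD'_T W u 0 1

theorem repD'_C (u : ℂ) : repD' W (QISMI.C u) = -hermiteOp (opX W) (opD W) u :=
  repD'_T W u 1 0

theorem repD'_D (u : ℂ) : repD' W (QISMI.D u) = opD W :=
  repD'_T W u 1 1

theorem repB_qdet (a c u : ℂ) : repB W a c (QISMI.qdet u) =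
    (-u ^ 2 + (c - 2 * a) * u + (a * (c - a) - c / 2 + 1 / 4)) • 1 := by
  rw [QISMI.qdet, map_sub, map_mul, map_mul]
  simp only [QISMI.A, QISMI.B, QISMI.C, QISMI.D, repB_T]
  exact qdet_lOperatorB (E := Module.End ℂ W) (opD_mul_opX W) a c u

theorem repD'_qdet (u : ℂ) : repD' W (QISMI.qdet u) = (u - 1 / 2) • 1 := by
  rw [QISMI.qdet, map_sub, map_mul, map_mul]
  simp only [QISMI.A, QISMI.B, QISMI.C, QISMI.D, repD'_T]
  exact qdet_lOperatorD' (opX W) (opD W) u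

end Representations

/-! ### Taylor coefficients at the origin -/

section Taylor

variable (W : Submodule ℂ (ℂ → ℂ)) [StableSpace W]

/-- The functional `f ↦ f⁽ᵏ⁾(0)` on a space of entire functions. -/
noncomputable def derivAtZero (k : ℕ) : W →ₗ[ℂ] ℂ where
  toFun f := iteratedDeriv k (f : ℂ → ℂ) 0
  map_add' f g := iteratedDeriv_add (StableSpace.differentiable _ f.2).contDiff.contDiffAt
    (StableSpace.differentiable _ g.2).contDiff.contDiffAt
  map_smul' r f :=
    iteratedDeriv_const_smul (StableSpace.differentiable _ f.2).contDiff.contDiffAt r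

variable {W}

theorem derivAtZero_apply (k : ℕ) (f : W) : derivAtZero W k f = iteratedDeriv k (f : ℂ → ℂ) 0 := rfl

theorem derivAtZero_zero (f : W) : derivAtZero W 0 f = (f : ℂ → ℂ) 0 := by
  rw [derivAtZero_apply, iteratedDeriv_zero]

theorem derivAtZero_one (f : W) : derivAtZero W 1 f = deriv (f : ℂ → ℂ) 0 := by
  rw [derivAtZero_apply, iteratedDeriv_one]

theorem derivAtZero_opD (k : ℕ) (f : W) :
    derivAtZero W k (opD W f) = derivAtZero W (k + 1) f :=
  congrFun iteratedDeriv_succ'.symm 0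

theorem derivAtZero_opX (k : ℕ) (f : W) :
    derivAtZero W k (opX W f) = k * derivAtZero W (k - 1) f := by
  refine (congrFun (iteratedDeriv_id_mul_entire (StableSpace.differentiable _ f.2) k) 0).trans ?_
  rw [zero_mul, zero_add, derivAtZero_apply]

theorem eq_of_derivAtZero_eq {f g : W} (h : ∀ k, derivAtZero W k f = derivAtZero W k g) :
    f = g := by
  have hf := StableSpace.differentiable _ f.2
  have hg := StableSpace.differentiable _ g.2
  simp only [derivAtZero_apply] at h
  ext z
  rw [← Complex.taylorSeries_eq_of_entire' 0 z hf, ← Complex.taylorSeries_eq_of_entire' 0 z hg]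
  simp only [h]

theorem opX_injective : Function.Injective (opX W) := fun f g h =>
  eq_of_derivAtZero_eq fun k => by
    have hk := congrArg (derivAtZero W (k + 1)) h
    rw [derivAtZero_opX, derivAtZero_opX, Nat.add_sub_cancel] at hk
    exact mul_left_cancel₀ (Nat.cast_ne_zero.2 k.succ_ne_zero) hk

theorem derivAtZero_kummerOp (a c : ℂ) (k : ℕ) (f : W) :
    derivAtZero W k (kummerOp (opX W) (opD W) a c f) =
      (k + c) * derivAtZero W (k + 1) f - (k + a) * derivAtZero W k f := by
  simp only [kummerOp, sq, LinearMap.sub_apply, LinearMap.add_apply, LinearMap.smul_apply,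
    Module.End.mul_apply, Module.End.one_apply, map_sub, map_add, map_smul, derivAtZero_opX,
    derivAtZero_opD, smul_eq_mul]
  cases k with
  | zero => simp
  | succ k =>
    push_cast [Nat.add_sub_cancel]
    ring

theorem derivAtZero_hermiteOp (u : ℂ) (k : ℕ) (f : W) :
    derivAtZero W k (hermiteOp (opX W) (opD W) u f) =
      derivAtZero W (k + 2) f - (k + u) * derivAtZero W k f := by
  simp only [hermiteOp, sq, LinearMap.sub_apply, LinearMap.smul_apply, Module.End.mul_apply,
    Module.End.one_apply, map_sub, map_smul, derivAtZero_opX, derivAtZero_opD, smul_eq_mul]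
  cases k with
  | zero => simp
  | succ k =>
    push_cast [Nat.add_sub_cancel]
    ring

theorem eq_of_kummerOp_eq_zero {a c : ℂ} (hc : ∀ n : ℕ, c ≠ -(n : ℂ)) {f g : W}
    (hf : kummerOp (opX W) (opD W) a c f = 0) (hg : kummerOp (opX W) (opD W) a c g = 0)
    (h₀ : derivAtZero W 0 f = derivAtZero W 0 g) : f = g := by
  refine eq_of_derivAtZero_eq fun k => ?_
  induction k with
  | zero => exact h₀
  | succ k ih =>
    have hf' := derivAtZero_kummerOp a c k f
    have hg' := derivAtZero_kummerOp a c k g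
    rw [hf, map_zero] at hf'
    rw [hg, map_zero, ← ih] at hg'
    refine mul_left_cancel₀ (a := (k : ℂ) + c) (fun h => hc k ?_) ?_
    · linear_combination h
    · linear_combination hg' - hf'

theorem eq_of_hermiteOp_eq_zero {u : ℂ} {f g : W}
    (hf : hermiteOp (opX W) (opD W) u f = 0) (hg : hermiteOp (opX W) (opD W) u g = 0)
    (h₀ : derivAtZero W 0 f = derivAtZero W 0 g) (h₁ : derivAtZero W 1 f = derivAtZero W 1 g) :
    f = g := by
  refine eq_of_derivAtZero_eq fun k => ?_
  induction k using Nat.twoStepInduction with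
  | zero => exact h₀
  | one => exact h₁
  | more k ih _ =>
    have hf' := derivAtZero_hermiteOp u k f
    have hg' := derivAtZero_hermiteOp u k g
    rw [hf, map_zero] at hf'
    rw [hg, map_zero, ← ih] at hg'
    linear_combination hg' - hf'

end Taylor

/-! ### The confluent hypergeometric function -/

section Kummer

variable {c : ℂ}

theorem ascPochhammer_eval_ne_zero (hc : ∀ n : ℕ, c ≠ -(n : ℂ)) (k : ℕ) :
    (ascPochhammer ℂ k).eval c ≠ 0 := by
  rw [Ne, ascPochhammer_eval_eq_zero_iff]
  rintro ⟨n, -, hn⟩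
  exact hc n (by rw [hn, neg_neg])

theorem Gamma_mul_regularizedHGFunCoeff (hc : ∀ n : ℕ, c ≠ -(n : ℂ)) (a : ℂ) (k : ℕ) :
    Complex.Gamma c * Complex.regularizedHGFunCoeff {a} {c} k =
      (ascPochhammer ℂ k).eval a / ((ascPochhammer ℂ k).eval c * (k ! : ℂ)) := by
  rw [Complex.regularizedHGFunCoeff, Multiset.map_singleton, Multiset.map_singleton,
    Multiset.prod_singleton, Multiset.prod_singleton, ← Complex.Gamma_add_nat_div_Gamma_eq c hc]
  have hΓ : Complex.Gamma c ≠ 0 := Complex.Gamma_ne_zero hc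
  field_simp

theorem oneFOne_eq_regularizedHGFun (hc : ∀ n : ℕ, c ≠ -(n : ℂ)) (a : ℂ) :
    oneFOne a c = fun x => Complex.Gamma c * Complex.regularizedHGFun {a} {c} x := by
  funext x
  rw [oneFOne, Complex.regularizedHGFun, FormalMultilinearSeries.sum, ← tsum_mul_left]
  refine tsum_congr fun k => ?_
  rw [FormalMultilinearSeries.apply_eq_pow_smul_coeff, Complex.regularizedHGFunSeries_coeff,
    smul_eq_mul, mul_left_comm, Gamma_mul_regularizedHGFunCoeff hc, mul_comm]

theorem hasFPowerSeriesOnBall_oneFOne (hc : ∀ n : ℕ, c ≠ -(n : ℂ)) (a : ℂ) :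
    HasFPowerSeriesOnBall (oneFOne a c)
      (Complex.Gamma c • Complex.regularizedHGFunSeries {a} {c}) 0 ⊤ := by
  rw [oneFOne_eq_regularizedHGFun hc]
  have hradius : (Complex.regularizedHGFunSeries {a} {c}).radius = ⊤ :=
    Complex.radius_regularizedHGFunSeries_eq_top (by simp)
  have h := (Complex.regularizedHGFunSeries {a} {c}).hasFPowerSeriesOnBall (by simp [hradius])
  rw [hradius] at h
  exact h.const_smul (c := Complex.Gamma c)

theorem differentiable_oneFOne (hc : ∀ n : ℕ, c ≠ -(n : ℂ)) (a : ℂ) :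
    Differentiable ℂ (oneFOne a c) := by
  have h := (hasFPowerSeriesOnBall_oneFOne hc a).differentiableOn
  rwa [Metric.eball_top, differentiableOn_univ] at h

/-- The function `₁F₁(a; c; ·)` as an element of the space of entire functions. -/
noncomputable def kummerFun (a : ℂ) (hc : ∀ n : ℕ, c ≠ -(n : ℂ)) : entireFun :=
  ⟨oneFOne a c, differentiable_oneFOne hc a⟩

theorem derivAtZero_kummerFun (a : ℂ) (hc : ∀ n : ℕ, c ≠ -(n : ℂ)) (k : ℕ) :
    derivAtZero entireFun k (kummerFun a hc) =
      (ascPochhammer ℂ k).eval a / (ascPochhammer ℂ k).eval c := by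
  have h := (hasFPowerSeriesOnBall_oneFOne hc a).factorial_smul (1 : ℂ) k
  rw [FormalMultilinearSeries.smul_apply, smul_apply,
    FormalMultilinearSeries.apply_eq_pow_smul_coeff, Complex.regularizedHGFunSeries_coeff,
    one_pow, one_smul, smul_eq_mul, Gamma_mul_regularizedHGFunCoeff hc, nsmul_eq_mul] at h
  rw [derivAtZero_apply, iteratedDeriv_eq_iteratedFDeriv, kummerFun, ← h]
  have hk : (k ! : ℂ) ≠ 0 := Nat.cast_ne_zero.2 k.factorial_ne_zero
  field_simp

theorem derivAtZero_zero_kummerFun (a : ℂ) (hc : ∀ n : ℕ, c ≠ -(n : ℂ)) :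
    derivAtZero entireFun 0 (kummerFun a hc) = 1 := by
  simp [derivAtZero_kummerFun]

theorem kummerFun_ne_zero (a : ℂ) (hc : ∀ n : ℕ, c ≠ -(n : ℂ)) : kummerFun a hc ≠ 0 := fun h => by
  simpa [h] using derivAtZero_zero_kummerFun a hc

theorem kummerOp_kummerFun (a : ℂ) (hc : ∀ n : ℕ, c ≠ -(n : ℂ)) :
    kummerOp (opX entireFun) (opD entireFun) a c (kummerFun a hc) = 0 := by
  refine eq_of_derivAtZero_eq fun k => ?_
  have h := ascPochhammer_eval_ne_zero hc (k + 1)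
  rw [derivAtZero_kummerOp, derivAtZero_kummerFun, derivAtZero_kummerFun, map_zero]
  simp only [ascPochhammer_succ_right, Polynomial.eval_mul, Polynomial.eval_add,
    Polynomial.eval_X, Polynomial.eval_natCast] at h ⊢
  have hck : c + k ≠ 0 := right_ne_zero_of_mul h
  have hpoch : (ascPochhammer ℂ k).eval c ≠ 0 := left_ne_zero_of_mul h
  field_simp
  ring

theorem eq_smul_kummerFun {a : ℂ} (hc : ∀ n : ℕ, c ≠ -(n : ℂ)) {f : entireFun}
    (hf : kummerOp (opX entireFun) (opD entireFun) a c f = 0) :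
    f = derivAtZero entireFun 0 f • kummerFun a hc :=
  eq_of_kummerOp_eq_zero hc hf (by rw [map_smul, kummerOp_kummerFun, smul_zero])
    (by rw [map_smul, derivAtZero_zero_kummerFun, smul_eq_mul, mul_one])

theorem isLadder_kummerFun (a : ℂ) (hc : ∀ n : ℕ, c ≠ -(n : ℂ)) :
    QISMI.IsLadder (repB entireFun a c) (fun u => kummerFun (a + u) hc)
      (fun u => c - a - u) (fun u => a + u) := by
  set ρ := repB entireFun a c with hρ
  have ker_C (u : ℂ) (f : entireFun) : f ∈ LinearMap.ker (ρ (QISMI.C u)) ↔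
      kummerOp (opX entireFun) (opD entireFun) (a + u) c f = 0 := by
    rw [LinearMap.mem_ker, hρ, repB_C, LinearMap.neg_apply, neg_eq_zero]
  have kummerFun_mem (u : ℂ) : kummerFun (a + u) hc ∈ LinearMap.ker (ρ (QISMI.C u)) :=
    (ker_C u _).2 (kummerOp_kummerFun _ hc)
  refine ⟨fun u => kummerFun_ne_zero _ hc, fun u => le_antisymm (fun f hf => ?_) ?_,
    fun u => ?_, fun u => ?_⟩
  · exact Submodule.mem_span_singleton.2 ⟨_, (eq_smul_kummerFun hc ((ker_C u f).1 hf)).symm⟩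
  · exact (Submodule.span_singleton_le_iff_mem _ _).2 (kummerFun_mem u)
  · have h := QISMI.A_apply_mem_ker_C (kummerFun_mem u)
    rw [eq_smul_kummerFun hc ((ker_C _ _).1 h), hρ, repB_A]
    simp [derivAtZero_opX, derivAtZero_zero_kummerFun]
  · have h := QISMI.D_apply_mem_ker_C (kummerFun_mem u)
    rw [eq_smul_kummerFun hc ((ker_C _ _).1 h), hρ, repB_D]
    simp [derivAtZero_opX, derivAtZero_zero_kummerFun]

theorem stringConditions_repB_bot_top {a u₀ : ℂ} (hc : ∀ n : ℕ, c ≠ -(n : ℂ))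
    (ha : ∀ m : ℤ, u₀ ≠ -a + m) (hca : ∀ m : ℤ, u₀ ≠ c - a + m) :
    QISMI.StringConditions (repB entireFun a c) u₀ ⊥ ⊤ := by
  refine (isLadder_kummerFun a hc).stringConditions_bot_top (fun m h => hca (-m) ?_)
    fun m h => ha (-m) ?_
  all_goals push_cast
  · linear_combination -h
  · linear_combination h

theorem stringConditions_repB_bot_one (a : ℂ) (hc : ∀ n : ℕ, c ≠ -(n : ℂ)) :
    QISMI.StringConditions (repB entireFun a c) (-a) ⊥ 1 :=
  (isLadder_kummerFun a hc).stringConditions_bot_one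
    (fun n h => hc n (by linear_combination h)) fun n => by
    rw [← add_sub_assoc, add_neg_cancel, zero_sub, neg_eq_zero, Nat.cast_eq_zero]

theorem ascPochhammer_eval_neg_natCast (n k : ℕ) :
    (ascPochhammer ℂ k).eval (-(n : ℂ)) = (-1) ^ k * (n.descFactorial k : ℂ) := by
  rw [ascPochhammer_eval_neg_eq_descPochhammer, descPochhammer_eval_eq_descFactorial]

theorem oneFOne_neg_natCast (n : ℕ) (c x : ℂ) : oneFOne (-(n : ℂ)) c x =
    ∑ k ∈ Finset.range (n + 1), (-1) ^ k * (n.descFactorial k : ℂ) /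
      ((ascPochhammer ℂ k).eval c * (k ! : ℂ)) * x ^ k := by
  simp only [oneFOne, ascPochhammer_eval_neg_natCast]
  refine tsum_eq_sum fun k hk => ?_
  have hnk : n < k := by simpa [Nat.lt_succ_iff] using hk
  simp [Nat.descFactorial_of_lt hnk]

theorem ascPochhammer_eval_eq_mul {n k : ℕ} (hkn : k ≤ n) (c : ℂ) :
    (ascPochhammer ℂ n).eval c =
      (ascPochhammer ℂ k).eval c * (ascPochhammer ℂ (n - k)).eval (c + k) := by
  have h := ascPochhammer_mul ℂ k (n - k)
  rw [Nat.add_sub_cancel' hkn] at h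
  simp [← h]

theorem laguerre_eq_oneFOne (hc : ∀ n : ℕ, c ≠ -(n : ℂ)) (n : ℕ) (x : ℂ) :
    laguerre n (c - 1) x =
      (ascPochhammer ℂ n).eval c / (n ! : ℂ) * oneFOne (-(n : ℂ)) c x := by
  rw [oneFOne_neg_natCast, laguerre, Finset.mul_sum]
  refine Finset.sum_congr rfl fun k hk => ?_
  have hkn : k ≤ n := Nat.lt_succ_iff.1 (Finset.mem_range.1 hk)
  have hfact : ((n - k)! : ℂ) * (n.descFactorial k : ℂ) = (n ! : ℂ) := by
    exact_mod_cast Nat.factorial_mul_descFactorial hkn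
  have hpoch := ascPochhammer_eval_ne_zero hc k
  have hnk : ((n - k)! : ℂ) ≠ 0 := Nat.cast_ne_zero.2 (n - k).factorial_ne_zero
  have hn : (n ! : ℂ) ≠ 0 := Nat.cast_ne_zero.2 n.factorial_ne_zero
  have hk : (k ! : ℂ) ≠ 0 := Nat.cast_ne_zero.2 k.factorial_ne_zero
  rw [ascPochhammer_eval_eq_mul hkn, show c - 1 + k + 1 = c + k by ring]
  field_simp
  linear_combination -((ascPochhammer ℂ (n - k)).eval (c + k) * x ^ k) * hfact

end Kummer

/-! ### The functions `e^{x²/4} D_{-u}(x)` -/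

section Weber

theorem hermiteOp_opD_apply {W : Submodule ℂ (ℂ → ℂ)} [StableSpace W] {u : ℂ} {f : W}
    (hf : hermiteOp (opX W) (opD W) u f = 0) :
    hermiteOp (opX W) (opD W) (u + 1) (opD W f) = 0 := by
  have h := QISMI.D_apply_mem_ker_C (ρ := repD' W) (u := u) (w := f)
  simpa [repD'_C, repD'_D, hf] using h

theorem hermiteOp_opD_sub_opX_apply {W : Submodule ℂ (ℂ → ℂ)} [StableSpace W] {u : ℂ} {f : W}
    (hf : hermiteOp (opX W) (opD W) u f = 0) :
    hermiteOp (opX W) (opD W) (u - 1) ((opD W - opX W) f) = 0 := by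
  have h := QISMI.A_apply_mem_ker_C (ρ := repD' W) (u := u) (w := f)
  simpa only [repD'_C, repD'_A, LinearMap.mem_ker, LinearMap.neg_apply, neg_eq_zero, hf,
    forall_const] using h

/-- The operator `f ↦ f(x²/2)`, which turns solutions of Kummer's equation into solutions of
Hermite's equation. -/
noncomputable def compSqHalf : Module.End ℂ entireFun where
  toFun f := ⟨fun x => (f : ℂ → ℂ) (x ^ 2 / 2), by
    have hf : Differentiable ℂ (f : ℂ → ℂ) := f.2
    exact hf.comp (by fun_prop)⟩
  map_add' _ _ := rfl
  map_smul' _ _ := rfl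

theorem opD_mul_compSqHalf :
    opD entireFun * compSqHalf = opX entireFun * (compSqHalf * opD entireFun) := by
  ext f x
  have hf : Differentiable ℂ (f : ℂ → ℂ) := f.2
  have hsq : HasDerivAt (fun x : ℂ => x ^ 2 / 2) x x := by
    simpa using ((hasDerivAt_id x).pow 2).div_const 2
  exact ((hf _).hasDerivAt.comp x hsq).deriv.trans (mul_comm _ _)

theorem opX_mul_opX_mul_compSqHalf :
    opX entireFun * (opX entireFun * compSqHalf) = (2 : ℂ) • (compSqHalf * opX entireFun) := by
  ext f x
  change x * (x * (f : ℂ → ℂ) (x ^ 2 / 2)) = 2 * (x ^ 2 / 2 * (f : ℂ → ℂ) (x ^ 2 / 2))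
  ring

theorem derivAtZero_zero_compSqHalf (f : entireFun) :
    derivAtZero entireFun 0 (compSqHalf f) = derivAtZero entireFun 0 f := by
  rw [derivAtZero_zero, derivAtZero_zero]
  change (f : ℂ → ℂ) (0 ^ 2 / 2) = (f : ℂ → ℂ) 0
  norm_num

theorem derivAtZero_one_compSqHalf (f : entireFun) :
    derivAtZero entireFun 1 (compSqHalf f) = 0 := by
  have h := LinearMap.congr_fun opD_mul_compSqHalf f
  simp only [Module.End.mul_apply] at h
  rw [← zero_add 1, ← derivAtZero_opD, h, derivAtZero_opX, Nat.cast_zero, zero_mul]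

theorem ne_neg_natCast_of_re_pos {c : ℂ} (hc : 0 < c.re) (n : ℕ) : c ≠ -(n : ℂ) := by
  rintro rfl
  exact hc.not_ge (by simp)

theorem half_ne_neg_natCast : ∀ n : ℕ, (1 / 2 : ℂ) ≠ -(n : ℂ) :=
  ne_neg_natCast_of_re_pos (by norm_num)

theorem three_halves_ne_neg_natCast : ∀ n : ℕ, (3 / 2 : ℂ) ≠ -(n : ℂ) :=
  ne_neg_natCast_of_re_pos (by norm_num)

/-- The even solution of `f'' - x f' - u f = 0` with `f(0) = 1`. -/
noncomputable def hermiteEven (u : ℂ) : entireFun :=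
  compSqHalf (kummerFun (u / 2) half_ne_neg_natCast)

/-- The odd solution of `f'' - x f' - u f = 0` with `f'(0) = 1`. -/
noncomputable def hermiteOdd (u : ℂ) : entireFun :=
  opX entireFun (compSqHalf (kummerFun ((1 + u) / 2) three_halves_ne_neg_natCast))

theorem hermiteOp_hermiteEven (u : ℂ) :
    hermiteOp (opX entireFun) (opD entireFun) u (hermiteEven u) = 0 := by
  have h := LinearMap.congr_fun (hermiteOp_mul_of_sq_half (E := Module.End ℂ entireFun)
    (opD_mul_opX _) opD_mul_compSqHalf opX_mul_opX_mul_compSqHalf u)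
    (kummerFun (u / 2) half_ne_neg_natCast)
  simpa only [hermiteEven, LinearMap.smul_apply, Module.End.mul_apply, kummerOp_kummerFun,
    map_zero, smul_zero] using h

theorem hermiteOp_hermiteOdd (u : ℂ) :
    hermiteOp (opX entireFun) (opD entireFun) u (hermiteOdd u) = 0 := by
  have h := LinearMap.congr_fun (hermiteOp_mul_mul_of_sq_half (E := Module.End ℂ entireFun)
    (opD_mul_opX _) opD_mul_compSqHalf opX_mul_opX_mul_compSqHalf u)
    (kummerFun ((1 + u) / 2) three_halves_ne_neg_natCast)
  simpa only [hermiteOdd, LinearMap.smul_apply, Module.End.mul_apply, kummerOp_kummerFun,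
    map_zero, smul_zero] using h

/-- The value of `e^{x²/4} D_{-u}(x)` at `x = 0`; the derivative there is `-weberCoeff (u - 1)`. -/
noncomputable def weberCoeff (u : ℂ) : ℂ :=
  2 ^ (-u / 2) * (Real.sqrt Real.pi : ℂ) / Complex.Gamma ((1 + u) / 2)

theorem weberCoeff_sub_one (u : ℂ) : weberCoeff (u - 1) = u * weberCoeff (u + 1) := by
  have hpow : (2 : ℂ) ^ (-(u - 1) / 2) = 2 * 2 ^ (-(u + 1) / 2) := by
    rw [show -(u - 1) / 2 = 1 + -(u + 1) / 2 by ring, Complex.cpow_add _ _ two_ne_zero,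
      Complex.cpow_one]
  rw [weberCoeff, weberCoeff, hpow, show (1 + (u - 1)) / 2 = u / 2 by ring,
    show (1 + (u + 1)) / 2 = u / 2 + 1 by ring, div_eq_mul_inv, div_eq_mul_inv,
    Complex.one_div_Gamma_eq_self_mul_one_div_Gamma_add_one (u / 2)]
  ring

theorem weberCoeff_eq_zero_iff {u : ℂ} :
    weberCoeff u = 0 ↔ Complex.Gamma ((1 + u) / 2) = 0 := by
  simp [weberCoeff, Complex.cpow_eq_zero_iff, Real.pi_pos.le, Real.pi_ne_zero]

theorem weberCoeff_zero : weberCoeff 0 = 1 := by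
  have hsqrt : (Real.sqrt Real.pi : ℂ) = (Real.pi : ℂ) ^ (1 / 2 : ℂ) := by
    rw [Real.sqrt_eq_rpow, Complex.ofReal_cpow Real.pi_pos.le]
    norm_num
  have hpi : (Real.pi : ℂ) ^ (1 / 2 : ℂ) ≠ 0 := by simp [Complex.cpow_eq_zero_iff]
  rw [weberCoeff, add_zero, Complex.Gamma_one_half_eq, hsqrt, neg_zero, zero_div,
    Complex.cpow_zero, one_mul, div_self hpi]

/-- The function `e^{x²/4} D_{-u}(x)`, with `D_ν` the parabolic cylinder function. -/
noncomputable def weber (u : ℂ) : entireFun :=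
  weberCoeff u • hermiteEven u - weberCoeff (u - 1) • hermiteOdd u

theorem weber_apply (u x : ℂ) :
    (weber u : ℂ → ℂ) x = Complex.exp (x ^ 2 / 4) * parabolicCylinderD (-u) x := by
  have hexp : Complex.exp (x ^ 2 / 4) * Complex.exp (-x ^ 2 / 4) = 1 := by
    rw [← Complex.exp_add, neg_div, add_neg_cancel, Complex.exp_zero]
  have hsqrt : (Real.sqrt 2 : ℂ) = 2 ^ (1 / 2 : ℂ) := by
    rw [Real.sqrt_eq_rpow, Complex.ofReal_cpow zero_le_two]
    norm_num
  have hpow : (2 : ℂ) ^ (-(u - 1) / 2) = 2 ^ (-u / 2) * (Real.sqrt 2 : ℂ) := by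
    rw [hsqrt, ← Complex.cpow_add _ _ two_ne_zero]
    ring_nf
  change weberCoeff u * oneFOne (u / 2) (1 / 2) (x ^ 2 / 2) -
    weberCoeff (u - 1) * (x * oneFOne ((1 + u) / 2) (3 / 2) (x ^ 2 / 2)) = _
  rw [parabolicCylinderD, weberCoeff, weberCoeff, hpow, neg_neg, sub_neg_eq_add,
    add_sub_cancel]
  linear_combination -(2 : ℂ) ^ (-u / 2) * (Real.sqrt Real.pi : ℂ) *
    (oneFOne (u / 2) (1 / 2) (x ^ 2 / 2) / Complex.Gamma ((1 + u) / 2) -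
      (Real.sqrt 2 : ℂ) * x * oneFOne ((1 + u) / 2) (3 / 2) (x ^ 2 / 2) /
        Complex.Gamma (u / 2)) * hexp

theorem hermiteOp_weber (u : ℂ) :
    hermiteOp (opX entireFun) (opD entireFun) u (weber u) = 0 := by
  rw [weber, map_sub, map_smul, map_smul, hermiteOp_hermiteEven, hermiteOp_hermiteOdd,
    smul_zero, smul_zero, sub_zero]

theorem derivAtZero_zero_weber (u : ℂ) : derivAtZero entireFun 0 (weber u) = weberCoeff u := by
  simp [weber, hermiteEven, hermiteOdd, derivAtZero_opX, derivAtZero_zero_compSqHalf,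
    derivAtZero_zero_kummerFun]

theorem derivAtZero_one_weber (u : ℂ) :
    derivAtZero entireFun 1 (weber u) = -weberCoeff (u - 1) := by
  simp [weber, hermiteEven, hermiteOdd, derivAtZero_opX, derivAtZero_zero_compSqHalf,
    derivAtZero_one_compSqHalf, derivAtZero_zero_kummerFun]

theorem derivAtZero_two_weber (u : ℂ) :
    derivAtZero entireFun 2 (weber u) = u * weberCoeff u := by
  have h := derivAtZero_hermiteOp u 0 (weber u)
  rw [hermiteOp_weber, map_zero, derivAtZero_zero_weber] at h
  push_cast at h
  linear_combination -h

theorem eq_smul_weber_of_derivAtZero {u r : ℂ} {f : entireFun}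
    (hf : hermiteOp (opX entireFun) (opD entireFun) u f = 0)
    (h₀ : derivAtZero entireFun 0 f = r * weberCoeff u)
    (h₁ : derivAtZero entireFun 1 f = -(r * weberCoeff (u - 1))) : f = r • weber u :=
  eq_of_hermiteOp_eq_zero hf (by rw [map_smul, hermiteOp_weber, smul_zero])
    (by rw [h₀, map_smul, derivAtZero_zero_weber, smul_eq_mul])
    (by rw [h₁, map_smul, derivAtZero_one_weber, smul_eq_mul, mul_neg])

theorem opD_weber (u : ℂ) : opD entireFun (weber u) = (-u) • weber (u + 1) := by
  refine eq_smul_weber_of_derivAtZero (hermiteOp_opD_apply (hermiteOp_weber u)) ?_ ?_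
  · rw [derivAtZero_opD, zero_add, derivAtZero_one_weber, weberCoeff_sub_one, neg_mul]
  · rw [derivAtZero_opD, derivAtZero_two_weber, add_sub_cancel_right, neg_mul, neg_neg]

theorem opD_sub_opX_weber (u : ℂ) :
    (opD entireFun - opX entireFun) (weber u) = (-1 : ℂ) • weber (u - 1) := by
  refine eq_smul_weber_of_derivAtZero (hermiteOp_opD_sub_opX_apply (hermiteOp_weber u)) ?_ ?_ <;>
    rw [LinearMap.sub_apply, map_sub, derivAtZero_opD, derivAtZero_opX]
  · rw [zero_add, derivAtZero_one_weber, Nat.cast_zero, zero_mul, sub_zero, neg_one_mul]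
  · rw [derivAtZero_two_weber, weberCoeff_sub_one, Nat.sub_self, derivAtZero_zero_weber,
      sub_add_cancel]
    push_cast
    ring

theorem weber_eq_mul_add (u x : ℂ) : (weber u : ℂ → ℂ) x =
    x * (weber (u + 1) : ℂ → ℂ) x + (u + 1) * (weber (u + 2) : ℂ → ℂ) x := by
  have hA := opD_sub_opX_weber (u + 1)
  rw [LinearMap.sub_apply, opD_weber, add_sub_cancel_right, add_assoc, one_add_one_eq_two] at hA
  have h : -(u + 1) * (weber (u + 2) : ℂ → ℂ) x - x * (weber (u + 1) : ℂ → ℂ) x =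
      -1 * (weber u : ℂ → ℂ) x :=
    congrFun (congrArg Subtype.val hA) x
  linear_combination h

theorem iteratedDeriv_weber (p : ℕ) (u : ℂ) :
    ∃ r : ℂ, iteratedDeriv p (weber u : ℂ → ℂ) = r • (weber (u + p) : ℂ → ℂ) := by
  induction p generalizing u with
  | zero => exact ⟨1, by simp⟩
  | succ p ih =>
    obtain ⟨r, hr⟩ := ih (u + 1)
    have hderiv : deriv (weber u : ℂ → ℂ) = (-u) • (weber (u + 1) : ℂ → ℂ) :=
      congrArg Subtype.val (opD_weber u)
    refine ⟨-u * r, ?_⟩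
    rw [iteratedDeriv_succ', hderiv, mul_smul, Nat.cast_succ, add_comm (p : ℂ), ← add_assoc, ← hr]
    exact funext fun x => iteratedDeriv_const_smul
      (contDiff_of_mem_entireFun (weber (u + 1)).2 _).contDiffAt _

theorem weber_ne_zero (u : ℂ) : weber u ≠ 0 := fun h => by
  have h₀ := derivAtZero_zero_weber u
  have h₁ := derivAtZero_one_weber u
  rw [h, map_zero, eq_comm] at h₀
  rw [h, map_zero, eq_comm, neg_eq_zero] at h₁
  rw [weberCoeff_eq_zero_iff, Complex.Gamma_eq_zero_iff] at h₀ h₁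
  obtain ⟨m, hm⟩ := h₀
  obtain ⟨n, hn⟩ := h₁
  have hparity : (1 : ℂ) + 2 * m = 2 * n := by linear_combination 2 * hm - 2 * hn
  norm_cast at hparity
  omega

theorem weber_zero_apply (x : ℂ) : (weber 0 : ℂ → ℂ) x = 1 := by
  have hdiff : Differentiable ℂ (weber 0 : ℂ → ℂ) := (weber 0).2
  have hopD : opD entireFun (weber 0) = 0 := by rw [opD_weber, neg_zero, zero_smul]
  have hderiv : deriv (weber 0 : ℂ → ℂ) = 0 := congrArg Subtype.val hopD
  rw [is_const_of_deriv_eq_zero hdiff (congrFun hderiv) x 0, ← derivAtZero_zero,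
    derivAtZero_zero_weber, weberCoeff_zero]

theorem weber_neg_natCast (n : ℕ) :
    (weber (-(n : ℂ)) : ℂ → ℂ) = fun x => Polynomial.aeval x (Polynomial.hermite n) := by
  induction n with
  | zero =>
    funext x
    rw [Nat.cast_zero, neg_zero, weber_zero_apply, Polynomial.hermite_zero, Polynomial.C_1,
      map_one]
  | succ n ih =>
    funext x
    have h : deriv (weber (-(n : ℂ)) : ℂ → ℂ) x - x * (weber (-(n : ℂ)) : ℂ → ℂ) x =
        -1 * (weber (-(n : ℂ) - 1) : ℂ → ℂ) x :=
      congrFun (congrArg Subtype.val (opD_sub_opX_weber (-(n : ℂ)))) x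
    rw [ih, Polynomial.deriv_aeval] at h
    rw [Polynomial.hermite_succ, Nat.cast_succ, neg_add', map_sub, map_mul, Polynomial.aeval_X]
    linear_combination h

end Weber

/-! ### An integral representation for `Re u > 0` -/

section WeberIntegral

open MeasureTheory Set

/-- The integrand `t^{u-1} e^{-xt - t²/2}` of the integral representation of
`Γ(u) e^{x²/4} D_{-u}(x)`. -/
noncomputable def weberKernel (u x : ℂ) (t : ℝ) : ℂ :=
  (t : ℂ) ^ (u - 1) * Complex.exp (-x * t - t ^ 2 / 2)

theorem aestronglyMeasurable_weberKernel (u x : ℂ) :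
    AEStronglyMeasurable (weberKernel u x) (volume.restrict (Ioi 0)) := by
  have hcont : ContinuousOn (weberKernel u x) (Ioi 0) := by
    refine ContinuousOn.mul (fun t ht => ?_) (Continuous.continuousOn (by fun_prop))
    exact (Complex.continuousAt_ofReal_cpow_const t _ (Or.inr (ne_of_gt ht))).continuousWithinAt
  exact hcont.aestronglyMeasurable measurableSet_Ioi

theorem norm_weberKernel_le (u : ℂ) {x : ℂ} {b t : ℝ} (hx : ‖x‖ ≤ b) (ht : 0 < t) :
    ‖weberKernel u x t‖ ≤ Real.exp (b ^ 2) * (t ^ (u.re - 1) * Real.exp (-(1 / 4) * t ^ 2)) := by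
  have hre : (-x * (t : ℂ) - (t : ℂ) ^ 2 / 2).re = -x.re * t - t ^ 2 / 2 := by
    rw [← Complex.ofReal_pow, ← Complex.ofReal_ofNat, ← Complex.ofReal_div, Complex.sub_re,
      Complex.ofReal_re, Complex.re_mul_ofReal, Complex.neg_re]
  rw [weberKernel, norm_mul, Complex.norm_cpow_eq_rpow_re_of_pos ht, Complex.norm_exp, hre,
    Complex.sub_re, Complex.one_re, mul_left_comm, ← Real.exp_add]
  refine mul_le_mul_of_nonneg_left (Real.exp_le_exp.2 ?_) (Real.rpow_nonneg ht.le _)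
  have hxb : -x.re ≤ b := (neg_le_abs _).trans ((Complex.abs_re_le_norm x).trans hx)
  nlinarith [mul_le_mul_of_nonneg_right hxb ht.le, sq_nonneg (t / 2 - b)]

theorem integrableOn_weberBound {s : ℝ} (hs : 0 < s) (r : ℝ) :
    IntegrableOn (fun t : ℝ => r * (t ^ (s - 1) * Real.exp (-(1 / 4) * t ^ 2))) (Ioi 0) :=
  (integrableOn_rpow_mul_exp_neg_mul_sq (by norm_num) (by linarith)).const_mul r

theorem integrableOn_weberKernel {u : ℂ} (hu : 0 < u.re) (x : ℂ) :
    IntegrableOn (weberKernel u x) (Ioi 0) := by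
  refine (integrableOn_weberBound hu (Real.exp (‖x‖ ^ 2))).mono'
    (aestronglyMeasurable_weberKernel u x) ?_
  filter_upwards [ae_restrict_mem measurableSet_Ioi] with t ht
  exact norm_weberKernel_le u le_rfl ht

theorem ofReal_mul_weberKernel (u x : ℂ) {t : ℝ} (ht : 0 < t) :
    t * weberKernel u x t = weberKernel (u + 1) x t := by
  have hpow : (t : ℂ) ^ (u + 1 - 1) = (t : ℂ) ^ (u - 1) * t := by
    rw [add_sub_right_comm, Complex.cpow_add _ _ (Complex.ofReal_ne_zero.2 ht.ne'),
      Complex.cpow_one]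
  rw [weberKernel, weberKernel, hpow]
  ring

/-- The integral `∫₀^∞ t^{u-1} e^{-xt - t²/2} dt`, which converges for `Re u > 0`. -/
noncomputable def weberIntegral (u x : ℂ) : ℂ := ∫ t in Ioi (0 : ℝ), weberKernel u x t

theorem re_add_one_pos {u : ℂ} (hu : 0 < u.re) : 0 < (u + 1).re := by
  rw [Complex.add_re, Complex.one_re]
  linarith

theorem hasDerivAt_weberIntegral {u : ℂ} (hu : 0 < u.re) (x : ℂ) :
    HasDerivAt (weberIntegral u) (-weberIntegral (u + 1) x) x := by
  rw [weberIntegral, ← integral_neg]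
  refine (hasDerivAt_integral_of_dominated_loc_of_deriv_le
    (F := weberKernel u) (F' := fun x t => -weberKernel (u + 1) x t)
    (bound := fun t => Real.exp ((‖x‖ + 1) ^ 2) *
      (t ^ ((u + 1).re - 1) * Real.exp (-(1 / 4) * t ^ 2)))
    (Metric.ball_mem_nhds x one_pos)
    (Eventually.of_forall fun y => aestronglyMeasurable_weberKernel u y)
    (integrableOn_weberKernel hu x) (aestronglyMeasurable_weberKernel _ x).neg ?_
    (integrableOn_weberBound (re_add_one_pos hu) _) ?_).2
  · filter_upwards [ae_restrict_mem measurableSet_Ioi] with t ht y hy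
    rw [norm_neg]
    refine norm_weberKernel_le _ ?_ ht
    have hyx : ‖y - x‖ < 1 := mem_ball_iff_norm.1 hy
    linarith [norm_sub_norm_le y x]
  · filter_upwards [ae_restrict_mem measurableSet_Ioi] with t ht y _
    rw [← ofReal_mul_weberKernel u y ht]
    have hexponent : HasDerivAt (fun y : ℂ => -y * (t : ℂ) - (t : ℂ) ^ 2 / 2) (-1 * (t : ℂ)) y :=
      ((hasDerivAt_id y).neg.mul_const (t : ℂ)).sub_const ((t : ℂ) ^ 2 / 2)
    refine (hexponent.cexp.const_mul _).congr_deriv ?_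
    rw [weberKernel]
    ring

theorem hasDerivAt_weberKernel_add_one {u : ℂ} (hu : u ≠ 0) (x : ℂ) {t : ℝ} (ht : 0 < t) :
    HasDerivAt (weberKernel (u + 1) x)
      (u * weberKernel u x t - x * weberKernel (u + 1) x t - weberKernel (u + 2) x t) t := by
  have hpow : HasDerivAt (fun s : ℝ => (s : ℂ) ^ (u + 1 - 1)) (u * (t : ℂ) ^ (u - 1)) t := by
    rw [add_sub_cancel_right]
    exact hasDerivAt_ofReal_cpow_const ht.ne' hu
  have hexponent : HasDerivAt (fun s : ℂ => -x * s - s ^ 2 / 2) (-x - t) (t : ℂ) := by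
    refine (((hasDerivAt_id (t : ℂ)).const_mul (-x)).sub
      (((hasDerivAt_id (t : ℂ)).pow 2).div_const 2)).congr_deriv ?_
    simp
  refine (hpow.mul hexponent.comp_ofReal.cexp).congr_deriv ?_
  rw [show u + 2 = u + 1 + 1 by ring, ← ofReal_mul_weberKernel (u + 1) x ht]
  simp only [weberKernel]
  ring

theorem mul_weberIntegral {u : ℂ} (hu : 0 < u.re) (x : ℂ) :
    u * weberIntegral u x = x * weberIntegral (u + 1) x + weberIntegral (u + 2) x := by
  have hu0 : u ≠ 0 := by
    rintro rfl
    exact hu.false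
  have hint := (integrableOn_weberKernel hu x).const_mul u
  have hint₁ := integrableOn_weberKernel (re_add_one_pos hu) x
  have hint₂ := integrableOn_weberKernel (u := u + 2) (by
    rw [Complex.add_re, Complex.re_ofNat]
    positivity) x
  have hderiv := fun t (ht : t ∈ Ioi (0 : ℝ)) => hasDerivAt_weberKernel_add_one hu0 x ht
  have hcont : ContinuousWithinAt (weberKernel (u + 1) x) (Ici 0) 0 := by
    refine ContinuousAt.continuousWithinAt (ContinuousAt.mul ?_ (by fun_prop))
    exact Complex.continuousAt_ofReal_cpow_const 0 _ (Or.inl (by simpa using hu))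
  have hzero : weberKernel (u + 1) x 0 = 0 := by simp [weberKernel, hu0]
  have hdiff := (hint.sub (hint₁.const_mul x)).sub hint₂
  have hparts := integral_Ioi_of_hasDerivAt_of_tendsto hcont hderiv hdiff
    (tendsto_zero_of_hasDerivAt_of_integrableOn_Ioi hderiv hdiff hint₁)
  have hsub₁ := integral_sub hint (hint₁.const_mul x)
  have hsub₂ := integral_sub (hint.sub (hint₁.const_mul x)) hint₂
  simp only [Pi.sub_apply, hsub₁, hparts, hzero, integral_const_mul] at hsub₂
  simp only [weberIntegral]
  linear_combination -hsub₂

theorem weberIntegral_apply_zero {u : ℂ} (hu : 0 < u.re) :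
    weberIntegral u 0 = 2 ^ (u / 2 - 1) * Complex.Gamma (u / 2) := by
  have hsubst := mellin_comp_rpow (fun t : ℝ => Complex.exp (-((1 / 2 : ℝ) : ℂ) * t)) u 2
  have hmellin :
      mellin (fun t : ℝ => Complex.exp (-((1 / 2 : ℝ) : ℂ) * ((t ^ (2 : ℝ) : ℝ) : ℂ))) u =
        weberIntegral u 0 := by
    refine setIntegral_congr_fun measurableSet_Ioi fun t _ => ?_
    simp only [weberKernel, smul_eq_mul, Real.rpow_two]
    congr 2
    push_cast
    ring
  have hGamma := Complex.integral_cpow_mul_exp_neg_mul_Ioi (a := u / 2) (r := 1 / 2)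
    (by simpa using hu) (by norm_num)
  rw [hmellin, mellin] at hsubst
  rw [hsubst]
  simp only [smul_eq_mul, neg_mul] at hGamma ⊢
  push_cast at hGamma ⊢
  rw [hGamma, Complex.cpow_sub _ _ two_ne_zero]
  simp only [one_div, inv_inv, Complex.cpow_one, abs_two, Complex.real_smul, Complex.ofReal_inv,
    Complex.ofReal_ofNat]
  ring

theorem Gamma_mul_weberCoeff {u : ℂ} (hu : 0 < u.re) :
    Complex.Gamma u * weberCoeff u = 2 ^ (u / 2 - 1) * Complex.Gamma (u / 2) := by
  have hΓ : Complex.Gamma ((1 + u) / 2) ≠ 0 :=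
    Complex.Gamma_ne_zero_of_re_pos (by simpa [add_comm] using re_add_one_pos hu)
  have hdup := Complex.Gamma_mul_Gamma_add_half (u / 2)
  have hpow : (2 : ℂ) ^ (u / 2 - 1) * 2 ^ (1 - u) = 2 ^ (-u / 2) := by
    rw [← Complex.cpow_add _ _ two_ne_zero]
    ring_nf
  rw [← add_div, add_comm u 1, mul_div_cancel₀ u two_ne_zero] at hdup
  rw [weberCoeff, ← hpow]
  generalize (2 : ℂ) ^ (u / 2 - 1) = p
  field_simp
  linear_combination -p * hdup

/-- The integral `∫₀^∞ t^{u-1} e^{-xt - t²/2} dt` as an entire function of `x`. -/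
noncomputable def weberIntegralFun {u : ℂ} (hu : 0 < u.re) : entireFun :=
  ⟨weberIntegral u, fun x => (hasDerivAt_weberIntegral hu x).differentiableAt⟩

theorem opD_weberIntegralFun {u : ℂ} (hu : 0 < u.re) :
    opD entireFun (weberIntegralFun hu) = -weberIntegralFun (re_add_one_pos hu) :=
  Subtype.ext (funext fun x => (hasDerivAt_weberIntegral hu x).deriv)

theorem hermiteOp_weberIntegralFun {u : ℂ} (hu : 0 < u.re) :
    hermiteOp (opX entireFun) (opD entireFun) u (weberIntegralFun hu) = 0 := by
  simp only [hermiteOp, sq, LinearMap.sub_apply, LinearMap.smul_apply, Module.End.mul_apply,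
    Module.End.one_apply, opD_weberIntegralFun, map_neg, neg_neg, sub_neg_eq_add]
  ext x
  change weberIntegral (u + 1 + 1) x + x * weberIntegral (u + 1) x - u * weberIntegral u x = 0
  rw [mul_weberIntegral hu, add_assoc u, one_add_one_eq_two]
  ring

theorem derivAtZero_zero_weberIntegralFun {u : ℂ} (hu : 0 < u.re) :
    derivAtZero entireFun 0 (weberIntegralFun hu) = Complex.Gamma u * weberCoeff u := by
  rw [derivAtZero_zero, Gamma_mul_weberCoeff hu, ← weberIntegral_apply_zero hu, weberIntegralFun]

theorem weberIntegralFun_eq {u : ℂ} (hu : 0 < u.re) :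
    weberIntegralFun hu = Complex.Gamma u • weber u := by
  have hu0 : u ≠ 0 := by
    rintro rfl
    exact hu.false
  refine eq_smul_weber_of_derivAtZero (hermiteOp_weberIntegralFun hu)
    (derivAtZero_zero_weberIntegralFun hu) ?_
  rw [← zero_add 1, ← derivAtZero_opD, opD_weberIntegralFun, map_neg,
    derivAtZero_zero_weberIntegralFun, Complex.Gamma_add_one u hu0, weberCoeff_sub_one]
  ring

theorem norm_cexp_neg_sq_half_sub_one_le (t : ℝ) :
    ‖Complex.exp (-(t : ℂ) ^ 2 / 2) - 1‖ ≤ t ^ 2 / 2 := by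
  have hreal : Complex.exp (-(t : ℂ) ^ 2 / 2) - 1 = ((Real.exp (-t ^ 2 / 2) - 1 : ℝ) : ℂ) := by
    push_cast
    rfl
  have hlower := Real.add_one_le_exp (-t ^ 2 / 2)
  have hupper : Real.exp (-t ^ 2 / 2) ≤ 1 := Real.exp_le_one_iff.2 (by nlinarith [sq_nonneg t])
  rw [hreal, Complex.norm_real, Real.norm_eq_abs, abs_of_nonpos (by linarith)]
  linarith

theorem integrableOn_rpow_mul_exp_neg_mul {s x : ℝ} (hs : 0 < s) (hx : 0 < x) :
    IntegrableOn (fun t : ℝ => t ^ (s - 1) * Real.exp (-(x * t))) (Ioi 0) := by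
  simpa only [Real.rpow_one, neg_mul] using
    integrableOn_rpow_mul_exp_neg_mul_rpow (p := 1) (s := s - 1) (by linarith) one_pos hx

theorem norm_cpow_mul_cexp_neg_mul (u : ℂ) (x : ℝ) {t : ℝ} (ht : 0 < t) :
    ‖(t : ℂ) ^ (u - 1) * Complex.exp (-(x * t))‖ = t ^ (u.re - 1) * Real.exp (-(x * t)) := by
  rw [norm_mul, Complex.norm_cpow_eq_rpow_re_of_pos ht, Complex.sub_re, Complex.one_re,
    Complex.norm_exp, Complex.neg_re, ← Complex.ofReal_mul, Complex.ofReal_re]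

theorem integrableOn_cpow_mul_cexp_neg_mul {u : ℂ} (hu : 0 < u.re) {x : ℝ} (hx : 0 < x) :
    IntegrableOn (fun t : ℝ => (t : ℂ) ^ (u - 1) * Complex.exp (-(x * t))) (Ioi 0) := by
  refine (integrableOn_rpow_mul_exp_neg_mul hu hx).mono' ?_ ?_
  · refine ContinuousOn.aestronglyMeasurable (ContinuousOn.mul (fun t ht => ?_)
      (Continuous.continuousOn (by fun_prop))) measurableSet_Ioi
    exact (Complex.continuousAt_ofReal_cpow_const t _ (Or.inr (ne_of_gt ht))).continuousWithinAt
  · filter_upwards [ae_restrict_mem measurableSet_Ioi] with t ht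
    exact (norm_cpow_mul_cexp_neg_mul u x ht).le

theorem norm_weberKernel_sub_le (u : ℂ) (x : ℝ) {t : ℝ} (ht : 0 < t) :
    ‖weberKernel u x t - (t : ℂ) ^ (u - 1) * Complex.exp (-(x * t))‖ ≤
      1 / 2 * (t ^ (u.re + 2 - 1) * Real.exp (-(x * t))) := by
  have hfactor : weberKernel u x t - (t : ℂ) ^ (u - 1) * Complex.exp (-(x * t)) =
      (t : ℂ) ^ (u - 1) * Complex.exp (-(x * t)) * (Complex.exp (-(t : ℂ) ^ 2 / 2) - 1) := by
    rw [weberKernel, mul_sub, mul_assoc _ (Complex.exp _) (Complex.exp _), ← Complex.exp_add]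
    ring_nf
  have hpow : t ^ (u.re + 2 - 1) = t ^ (u.re - 1) * t ^ 2 := by
    rw [← Real.rpow_two, ← Real.rpow_add ht]
    ring_nf
  rw [hfactor, norm_mul, norm_cpow_mul_cexp_neg_mul u x ht, hpow]
  refine (mul_le_mul_of_nonneg_left (norm_cexp_neg_sq_half_sub_one_le t)
    (by positivity)).trans_eq ?_
  ring

theorem norm_weberIntegral_sub_le {u : ℂ} (hu : 0 < u.re) {x : ℝ} (hx : 0 < x) :
    ‖weberIntegral u x - Complex.Gamma u * (x : ℂ) ^ (-u)‖ ≤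
      Real.Gamma (u.re + 2) / 2 * x ^ (-u.re - 2) := by
  have hu2 : 0 < u.re + 2 := by linarith
  have hleading : Complex.Gamma u * (x : ℂ) ^ (-u) =
      ∫ t in Ioi (0 : ℝ), (t : ℂ) ^ (u - 1) * Complex.exp (-(x * t)) := by
    have harg : (x : ℂ).arg ≠ Real.pi := by
      rw [Complex.arg_ofReal_of_nonneg hx.le]
      exact Real.pi_pos.ne
    rw [Complex.integral_cpow_mul_exp_neg_mul_Ioi hu (by simpa using hx), one_div,
      Complex.inv_cpow _ _ harg, ← Complex.cpow_neg, mul_comm]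
  have herror : Real.Gamma (u.re + 2) / 2 * x ^ (-u.re - 2) =
      ∫ t in Ioi (0 : ℝ), 1 / 2 * (t ^ (u.re + 2 - 1) * Real.exp (-(x * t))) := by
    rw [integral_const_mul, Real.integral_rpow_mul_exp_neg_mul_Ioi hu2 hx, one_div x,
      Real.inv_rpow hx.le, ← Real.rpow_neg hx.le, neg_add']
    ring
  rw [hleading, herror, weberIntegral, ← integral_sub (integrableOn_weberKernel hu x)
    (integrableOn_cpow_mul_cexp_neg_mul hu hx)]
  refine norm_integral_le_of_norm_le ((integrableOn_rpow_mul_exp_neg_mul hu2 hx).const_mul _) ?_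
  filter_upwards [ae_restrict_mem measurableSet_Ioi] with t ht
  exact norm_weberKernel_sub_le u x ht

end WeberIntegral

/-! ### Asymptotics at infinity -/

section WeberAsymptotic

theorem isBigO_cpow_of_re_le {v w : ℂ} (h : v.re ≤ w.re) :
    (fun x : ℝ => (x : ℂ) ^ v) =O[atTop] fun x : ℝ => (x : ℂ) ^ w := by
  refine IsBigO.of_bound 1 ?_
  filter_upwards [eventually_ge_atTop 1] with x hx
  have hx0 : 0 < x := one_pos.trans_le hx
  rw [one_mul, Complex.norm_cpow_eq_rpow_re_of_pos hx0, Complex.norm_cpow_eq_rpow_re_of_pos hx0]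
  exact Real.rpow_le_rpow_of_exponent_le hx h

theorem ofReal_mul_cpow (w : ℂ) {x : ℝ} (hx : 0 < x) :
    (x : ℂ) * (x : ℂ) ^ w = (x : ℂ) ^ (w + 1) := by
  rw [Complex.cpow_add _ _ (Complex.ofReal_ne_zero.2 hx.ne'), Complex.cpow_one, mul_comm]

/-- The asymptotic relation `e^{x²/4} D_{-u}(x) = x^{-u} + O(x^{-u-2})` as `x → +∞`. -/
def WeberAsymptotic (u : ℂ) : Prop :=
  (fun x : ℝ => (weber u : ℂ → ℂ) x - (x : ℂ) ^ (-u)) =O[atTop] fun x : ℝ => (x : ℂ) ^ (-u - 2)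

theorem weberAsymptotic_of_re_pos {u : ℂ} (hu : 0 < u.re) : WeberAsymptotic u := by
  have hΓ : 0 < ‖Complex.Gamma u‖ := norm_pos_iff.2 (Complex.Gamma_ne_zero_of_re_pos hu)
  refine IsBigO.of_bound (Real.Gamma (u.re + 2) / 2 / ‖Complex.Gamma u‖) ?_
  filter_upwards [eventually_gt_atTop 0] with x hx
  have hbound := norm_weberIntegral_sub_le hu hx
  have heq : weberIntegral u x = Complex.Gamma u * (weber u : ℂ → ℂ) x :=
    congrFun (congrArg Subtype.val (weberIntegralFun_eq hu)) x
  rw [heq, ← mul_sub, norm_mul] at hbound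
  rw [Complex.norm_cpow_eq_rpow_re_of_pos hx, Complex.sub_re, Complex.neg_re, Complex.re_ofNat,
    div_mul_eq_mul_div, le_div_iff₀ hΓ, mul_comm]
  exact hbound

theorem WeberAsymptotic.isBigO {u : ℂ} (h : WeberAsymptotic u) :
    (fun x : ℝ => (weber u : ℂ → ℂ) x) =O[atTop] fun x : ℝ => (x : ℂ) ^ (-u) := by
  have hre : (-u - 2).re ≤ (-u).re := by simp
  simpa only [sub_add_cancel] using
    (IsBigO.trans h (isBigO_cpow_of_re_le hre)).add (isBigO_refl _ _)

theorem WeberAsymptotic.of_add {u : ℂ} (h₁ : WeberAsymptotic (u + 1))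
    (h₂ : WeberAsymptotic (u + 2)) : WeberAsymptotic u := by
  have hfirst : (fun x : ℝ => (x : ℂ) * ((weber (u + 1) : ℂ → ℂ) x - (x : ℂ) ^ (-(u + 1))))
      =O[atTop] fun x : ℝ => (x : ℂ) ^ (-u - 2) := by
    refine ((isBigO_refl (fun x : ℝ => (x : ℂ)) atTop).mul h₁).congr' EventuallyEq.rfl ?_
    filter_upwards [eventually_gt_atTop 0] with x hx
    rw [ofReal_mul_cpow _ hx]
    ring_nf
  have hsecond : (fun x : ℝ => (u + 1) * (weber (u + 2) : ℂ → ℂ) x) =O[atTop]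
      fun x : ℝ => (x : ℂ) ^ (-u - 2) := by
    rw [← neg_add']
    exact h₂.isBigO.const_mul_left (u + 1)
  refine (hfirst.add hsecond).congr' ?_ EventuallyEq.rfl
  filter_upwards [eventually_gt_atTop 0] with x hx
  rw [weber_eq_mul_add u x, mul_sub, ofReal_mul_cpow _ hx, neg_add', sub_add_cancel]
  ring

theorem weberAsymptotic (u : ℂ) : WeberAsymptotic u := by
  suffices h : ∀ n : ℕ, ∀ u : ℂ, -(n : ℝ) < u.re → WeberAsymptotic u by
    obtain ⟨n, hn⟩ := exists_nat_gt (-u.re)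
    exact h n u (neg_lt.1 hn)
  intro n
  induction n with
  | zero => exact fun u hu => weberAsymptotic_of_re_pos (by simpa using hu)
  | succ n ih =>
    intro u hu
    push_cast at hu
    refine (ih (u + 1) ?_).of_add (ih (u + 2) ?_)
    · rw [Complex.add_re, Complex.one_re]
      linarith
    · rw [Complex.add_re, Complex.re_ofNat]
      linarith

theorem weber_mem_polyGrowthFun (u : ℂ) : (weber u : ℂ → ℂ) ∈ polyGrowthFun := by
  refine ⟨(weber u).2, fun p => ?_⟩
  obtain ⟨r, hr⟩ := iteratedDeriv_weber p u
  obtain ⟨N, hN⟩ := exists_nat_ge (-(u + p).re)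
  have hgrowth := ((weberAsymptotic (u + p)).isBigO.trans
    (isBigO_cpow_of_re_le (w := (N : ℂ)) (by simpa using hN))).const_mul_left r
  refine ⟨N, ?_⟩
  rw [hr]
  refine hgrowth.trans (IsBigO.of_bound 1 (Eventually.of_forall fun x => ?_))
  rw [Complex.cpow_natCast, norm_pow, Complex.norm_real, norm_pow, one_mul]

end WeberAsymptotic

/-! ### Null spaces on the functions of polynomial growth -/

section Wronskian

/-- The Wronskian `f g' - f' g` of two functions on `ℂ`. -/
noncomputable def wronskian (f g : ℂ → ℂ) (x : ℂ) : ℂ := f x * deriv g x - deriv f x * g x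

variable {W : Submodule ℂ (ℂ → ℂ)} [StableSpace W] {u : ℂ}

theorem hermiteOp_apply (f : W) (x : ℂ) :
    (hermiteOp (opX W) (opD W) u f : ℂ → ℂ) x =
      deriv (deriv (f : ℂ → ℂ)) x - x * deriv (f : ℂ → ℂ) x - u * (f : ℂ → ℂ) x := by
  rw [hermiteOp, sq]
  rfl

theorem wronskian_mul_cexp_eq {f g : W} (hf : hermiteOp (opX W) (opD W) u f = 0)
    (hg : hermiteOp (opX W) (opD W) u g = 0) (x : ℂ) :
    wronskian f g x * Complex.exp (-(x ^ 2 / 2)) = wronskian f g 0 := by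
  have hderiv (x : ℂ) : HasDerivAt
      (fun x => wronskian f g x * Complex.exp (-(x ^ 2 / 2))) 0 x := by
    have hdf := StableSpace.differentiable _ f.2
    have hdg := StableSpace.differentiable _ g.2
    have hexponent : HasDerivAt (fun x : ℂ => -(x ^ 2 / 2)) (-x) x := by
      refine (((hasDerivAt_id x).pow 2).div_const 2).neg.congr_deriv ?_
      simp
    refine ((((hdf x).hasDerivAt.mul (differentiable_deriv_of_entire hdg x).hasDerivAt).sub
      ((differentiable_deriv_of_entire hdf x).hasDerivAt.mul (hdg x).hasDerivAt)).mul
        hexponent.cexp).congr_deriv ?_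
    have hfx := hermiteOp_apply (u := u) f x
    have hgx := hermiteOp_apply (u := u) g x
    rw [hf, Submodule.coe_zero, Pi.zero_apply] at hfx
    rw [hg, Submodule.coe_zero, Pi.zero_apply] at hgx
    simp only [Pi.sub_apply, Pi.mul_apply]
    linear_combination Complex.exp (-(x ^ 2 / 2)) *
      ((g : ℂ → ℂ) x * hfx - (f : ℂ → ℂ) x * hgx)
  have hconst := is_const_of_deriv_eq_zero (fun x => (hderiv x).differentiableAt)
    (fun x => (hderiv x).deriv) x 0
  simpa using hconst

theorem exists_smul_eq_of_wronskian_eq_zero {f g : W}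
    (hf : hermiteOp (opX W) (opD W) u f = 0) (hg : hermiteOp (opX W) (opD W) u g = 0)
    (hg0 : g ≠ 0) (hfg : wronskian f g 0 = 0) : ∃ r : ℂ, r • g = f := by
  rw [wronskian, sub_eq_zero, ← derivAtZero_zero, ← derivAtZero_zero, ← derivAtZero_one,
    ← derivAtZero_one] at hfg
  have hsmul (r : ℂ) : hermiteOp (opX W) (opD W) u (r • g) = 0 := by
    rw [map_smul, hg, smul_zero]
  by_cases h₀ : derivAtZero W 0 g = 0
  · have h₁ : derivAtZero W 1 g ≠ 0 := fun h₁ =>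
      hg0 (eq_of_hermiteOp_eq_zero hg (map_zero _) (by rw [h₀, map_zero]) (by rw [h₁, map_zero]))
    refine ⟨derivAtZero W 1 f / derivAtZero W 1 g, eq_of_hermiteOp_eq_zero (hsmul _) hf ?_ ?_⟩
    · rw [h₀, mul_zero, mul_eq_zero, or_iff_left h₁] at hfg
      rw [map_smul, h₀, smul_zero, hfg]
    · rw [map_smul, smul_eq_mul, div_mul_cancel₀ _ h₁]
  · refine ⟨derivAtZero W 0 f / derivAtZero W 0 g, eq_of_hermiteOp_eq_zero (hsmul _) hf ?_ ?_⟩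
    · rw [map_smul, smul_eq_mul, div_mul_cancel₀ _ h₀]
    · rw [map_smul, smul_eq_mul, div_mul_eq_mul_div, hfg, mul_div_cancel_right₀ _ h₀]

end Wronskian

section PolyGrowth

theorem cexp_neg_sq_half_isBigO :
    (fun x : ℝ => Complex.exp (-((x : ℂ) ^ 2 / 2))) =O[atTop] fun x : ℝ => Real.exp (-x) := by
  refine IsBigO.of_bound 1 ?_
  filter_upwards [eventually_ge_atTop 2] with x hx
  have hreal : -((x : ℂ) ^ 2 / 2) = ((-(x ^ 2 / 2) : ℝ) : ℂ) := by
    push_cast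
    rfl
  rw [hreal, Complex.norm_exp_ofReal, Real.norm_eq_abs, Real.abs_exp, one_mul]
  exact Real.exp_le_exp.2 (by nlinarith)

theorem tendsto_mul_mul_cexp_neg_sq_half {f g : ℝ → ℂ} {m n : ℕ}
    (hf : f =O[atTop] fun x : ℝ => x ^ m) (hg : g =O[atTop] fun x : ℝ => x ^ n) :
    Tendsto (fun x : ℝ => f x * g x * Complex.exp (-((x : ℂ) ^ 2 / 2))) atTop (nhds 0) := by
  refine ((hf.mul hg).mul cexp_neg_sq_half_isBigO).trans_tendsto ?_
  simpa only [← pow_add] using Real.tendsto_pow_mul_exp_neg_atTop_nhds_zero (m + n)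

theorem wronskian_eq_zero {u : ℂ} {f g : polyGrowthFun}
    (hf : hermiteOp (opX polyGrowthFun) (opD polyGrowthFun) u f = 0)
    (hg : hermiteOp (opX polyGrowthFun) (opD polyGrowthFun) u g = 0) :
    wronskian f g 0 = 0 := by
  obtain ⟨m₀, hf₀⟩ := f.2.2 0
  obtain ⟨m₁, hf₁⟩ := f.2.2 1
  obtain ⟨n₀, hg₀⟩ := g.2.2 0
  obtain ⟨n₁, hg₁⟩ := g.2.2 1
  simp only [iteratedDeriv_zero, iteratedDeriv_one] at hf₀ hf₁ hg₀ hg₁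
  have hlim := (tendsto_mul_mul_cexp_neg_sq_half hf₀ hg₁).sub
    (tendsto_mul_mul_cexp_neg_sq_half hf₁ hg₀)
  rw [sub_zero] at hlim
  refine tendsto_nhds_unique (tendsto_const_nhds (f := atTop (α := ℝ)))
    (hlim.congr fun x => ?_)
  rw [← wronskian_mul_cexp_eq hf hg x, wronskian, sub_mul]

/-- The function `e^{x²/4} D_{-u}(x)` as a function of polynomial growth. -/
noncomputable def weberPolyGrowth (u : ℂ) : polyGrowthFun := ⟨weber u, weber_mem_polyGrowthFun u⟩

theorem hermiteOp_weberPolyGrowth (u : ℂ) :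
    hermiteOp (opX polyGrowthFun) (opD polyGrowthFun) u (weberPolyGrowth u) = 0 := by
  ext x
  have h := hermiteOp_apply (u := u) (weber u) x
  rw [hermiteOp_weber] at h
  rw [hermiteOp_apply]
  exact h.symm

theorem weberPolyGrowth_ne_zero (u : ℂ) : weberPolyGrowth u ≠ 0 := fun h => by
  have hweber : (weber u : ℂ → ℂ) = 0 := congrArg Subtype.val h
  exact weber_ne_zero u (Subtype.ext hweber)

theorem isLadder_weberPolyGrowth :
    QISMI.IsLadder (repD' polyGrowthFun) weberPolyGrowth (fun _ => -1) (fun u => -u) where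
  ne_zero := weberPolyGrowth_ne_zero
  ker_C u := by
    ext f
    rw [LinearMap.mem_ker, repD'_C, LinearMap.neg_apply, neg_eq_zero,
      Submodule.mem_span_singleton]
    constructor
    · exact fun hf => exists_smul_eq_of_wronskian_eq_zero hf (hermiteOp_weberPolyGrowth u)
        (weberPolyGrowth_ne_zero u) (wronskian_eq_zero hf (hermiteOp_weberPolyGrowth u))
    · rintro ⟨r, rfl⟩
      rw [map_smul, hermiteOp_weberPolyGrowth, smul_zero]
  A_apply u := by
    rw [repD'_A]
    exact Subtype.ext (congrArg Subtype.val (opD_sub_opX_weber u) :)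
  D_apply u := by
    rw [repD'_D]
    exact Subtype.ext (congrArg Subtype.val (opD_weber u) :)

theorem stringConditions_repD'_bot_top {u₀ : ℂ} (hu₀ : ∀ m : ℤ, u₀ ≠ m) :
    QISMI.StringConditions (repD' polyGrowthFun) u₀ ⊥ ⊤ := by
  refine isLadder_weberPolyGrowth.stringConditions_bot_top
    (fun _ => neg_ne_zero.2 one_ne_zero) fun m h => hu₀ (-m) ?_
  push_cast
  linear_combination -h

theorem stringConditions_repD'_bot_one :
    QISMI.StringConditions (repD' polyGrowthFun) 0 ⊥ 1 :=
  isLadder_weberPolyGrowth.stringConditions_bot_one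
    (fun _ => neg_ne_zero.2 one_ne_zero) fun n => by
    rw [zero_sub, neg_neg, Nat.cast_eq_zero]

end PolyGrowth

theorem mainTheorem7 :
    -- Type B
    (∀ a c : ℂ, (∀ n : ℕ, c ≠ -(n : ℂ)) →
      ∃ (ρ : QISMI →ₐ[ℂ] Module.End ℂ entireFun) (F : ℂ → entireFun),
        -- a representation by the given operators, with `B₀` injective
        (∀ u : ℂ, (QISMI.T u).map ρ = typeB a c u) ∧
        (∀ u : ℂ, Function.Injective (ρ (QISMI.B u))) ∧
        -- with scalar quantum determinant `αδu² + Q₁u + Q₀`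
        (∀ u : ℂ, ρ (QISMI.qdet u) =
          (-u ^ 2 + (c - 2 * a) * u + (a * (c - a) - c / 2 + 1 / 4)) • 1) ∧
        -- the vectors `F(u)`
        (∀ u x : ℂ, (F u : ℂ → ℂ) x = oneFOne (a + u) c x) ∧
        (∀ u : ℂ, F u ≠ 0 ∧ ρ (QISMI.C u) (F u) = 0) ∧
        (∀ u : ℂ, ρ (QISMI.A u) (F u) = (c - a - u) • F (u - 1)) ∧
        (∀ u : ℂ, ρ (QISMI.D u) (F u) = (a + u) • F (u + 1)) ∧
        -- the sets `𝒟 = u₀ + ℤ` and `𝒟 = {-a, -a - 1, -a - 2, …}`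
        (∀ u₀ : ℂ, (∀ m : ℤ, u₀ ≠ -a + m) → (∀ m : ℤ, u₀ ≠ c - a + m) →
          QISMI.StringConditions ρ u₀ ⊥ ⊤) ∧
        QISMI.StringConditions ρ (-a) ⊥ 1 ∧
        -- Laguerre polynomials
        (∀ (n : ℕ) (x : ℂ), laguerre n (c - 1) x =
          (ascPochhammer ℂ n).eval c / (n.factorial : ℂ) * (F (-a - n) : ℂ → ℂ) x)) ∧
    -- Type D'
    (∃ (ρ : QISMI →ₐ[ℂ] Module.End ℂ polyGrowthFun) (F : ℂ → polyGrowthFun),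
        -- a representation by the given operators, with `B₀` injective
        (∀ u : ℂ, (QISMI.T u).map ρ = typeD' u) ∧
        (∀ u : ℂ, Function.Injective (ρ (QISMI.B u))) ∧
        -- with scalar quantum determinant
        (∀ u : ℂ, ρ (QISMI.qdet u) = (u - 1 / 2) • 1) ∧
        -- the vectors `F(u)`
        (∀ u x : ℂ, (F u : ℂ → ℂ) x = Complex.exp (x ^ 2 / 4) * parabolicCylinderD (-u) x) ∧
        (∀ u : ℂ, F u ≠ 0 ∧ ρ (QISMI.C u) (F u) = 0) ∧
        (∀ u : ℂ, ρ (QISMI.A u) (F u) = -F (u - 1)) ∧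
        (∀ u : ℂ, ρ (QISMI.D u) (F u) = (-u) • F (u + 1)) ∧
        -- their normalization `F(u)(x) = x^{-u} + O(x^{-u-2})` as `x → ∞`
        (∀ u : ℂ, (fun x : ℝ => (F u : ℂ → ℂ) x - (x : ℂ) ^ (-u)) =O[Filter.atTop]
          (fun x : ℝ => (x : ℂ) ^ (-u - 2))) ∧
        -- the sets `𝒟 = u₀ + ℤ` and `𝒟 = {0, -1, -2, …}`
        (∀ u₀ : ℂ, (∀ m : ℤ, u₀ ≠ m) → QISMI.StringConditions ρ u₀ ⊥ ⊤) ∧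
        QISMI.StringConditions ρ 0 ⊥ 1 ∧
        -- Hermite polynomials `He_n(x) = 2^{-n/2} H_n(2^{-1/2} x)`
        (∀ (n : ℕ) (x : ℂ),
          (F (-(n : ℂ)) : ℂ → ℂ) x = Polynomial.aeval x (Polynomial.hermite n))) := by
  constructor
  · intro a c hc
    have hF := isLadder_kummerFun a hc
    refine ⟨repB entireFun a c, fun u => kummerFun (a + u) hc, QISMI.map_T_lift _, fun u => ?_,
      repB_qdet entireFun a c, fun _ _ => rfl, fun u => ⟨hF.ne_zero u, hF.C_apply u⟩,
      hF.A_apply, hF.D_apply, fun _ => stringConditions_repB_bot_top hc,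
      stringConditions_repB_bot_one a hc, fun n x => ?_⟩
    · rw [repB_B]
      exact neg_injective.comp opX_injective
    · change _ = _ * oneFOne (a + (-a - n)) c x
      rw [laguerre_eq_oneFOne hc n x, ← add_sub_assoc, add_neg_cancel, zero_sub]
  · have hF := isLadder_weberPolyGrowth
    refine ⟨repD' polyGrowthFun, weberPolyGrowth, QISMI.map_T_lift _, fun u => ?_,
      repD'_qdet polyGrowthFun, weber_apply, fun u => ⟨hF.ne_zero u, hF.C_apply u⟩, fun u => ?_,
      hF.D_apply, weberAsymptotic, fun _ => stringConditions_repD'_bot_top,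
      stringConditions_repD'_bot_one, fun n => congrFun (weber_neg_natCast n)⟩
    · rw [repD'_B]
      exact neg_injective
    · rw [hF.A_apply, neg_one_smul]
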